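/- Let $(A,\mathfrak m)$ be a Gorenstein (Noetherian) local ring of Krull dimension $d$, and let $M$ be a maximal Cohen--Macaulay $A$-module (the zero module being allowed) which is free on the punctured spectrum, i.e. $M_{\mathfrak p}$ is a free $A_{\mathfrak p}$-module for every prime $\mathfrak p\neq\mathfrak m$. Let $N$ be a finitely generated $A$-module, let $I$ be an ideal of $A$, and let $j\ge d+1$ be an integer. Then $\operatorname{Ext}^j_A(N/I^{n+1}N,M)$ has finite length for every $n\ge 0$, and the function $$n\longmapsto \ell\bigl(\operatorname{Ext}^j_A(N/I^{n+1}N,M)\bigr)$$ is of polynomial type and of degree $\le d$; that is, there is a polynomial $P\in\mathbb Q[X]$, either zero or of degree at most $d$, such that $\ell\bigl(\operatorname{Ext}^j_A(N/I^{n+1}N,M)\bigr)=P(n)$ for all sufficiently large integers $n$. -/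

import Mathlib

open CategoryTheory CategoryTheory.Abelian

universe u

/-- A Noetherian local ring is Gorenstein if it has finite injective dimension as a module
over itself. -/
def IsGorensteinLocalRing (A : Type u) [CommRing A] [IsNoetherianRing A] [IsLocalRing A] : Prop :=
  ∃ n : ℕ, HasInjectiveDimensionLE (ModuleCat.of A A) n

/-- A finitely generated module `M` over a Noetherian local ring `A` is maximal Cohen-Macaulay if
`depth M = dim A`, i.e. if some `M`-regular sequence in the maximal ideal has length `dim A`
(for nonzero `M` its depth never exceeds `dim A`, and by Nakayama a weakly regular sequence in the
maximal ideal is regular). The zero module counts as maximal Cohen-Macaulay. -/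
def IsMaximalCohenMacaulay (A : Type u) [CommRing A] [IsNoetherianRing A] [IsLocalRing A]
    (M : Type u) [AddCommGroup M] [Module A M] : Prop :=
  Module.Finite A M ∧
    ∃ rs : List A, (∀ r ∈ rs, r ∈ IsLocalRing.maximalIdeal A) ∧
      RingTheory.Sequence.IsWeaklyRegular M rs ∧
      ((rs.length : ℕ) : WithBot ℕ∞) = ringKrullDim A

/-- `M` is free on the punctured spectrum: `M_p` is a free `A_p`-module for every prime `p`
different from the maximal ideal. -/
def IsFreeOnPuncturedSpectrum (A : Type u) [CommRing A] [IsLocalRing A]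
    (M : Type u) [AddCommGroup M] [Module A M] : Prop :=
  ∀ (p : Ideal A) [p.IsPrime], p ≠ IsLocalRing.maximalIdeal A →
    Module.Free (Localization.AtPrime p) (LocalizedModule p.primeCompl M)

/-- `f` is of polynomial type and of degree at most `d`: for all large `n`, `f n` is the value at
`n` of a rational polynomial of degree at most `d` (possibly the zero polynomial). -/
def IsOfPolynomialTypeDegreeLE (f : ℕ → ℕ) (d : ℕ) : Prop :=
  ∃ P : Polynomial ℚ, P.degree ≤ (d : WithBot ℕ) ∧
    ∀ᶠ n : ℕ in Filter.atTop, (f n : ℚ) = P.eval (n : ℚ)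

/-- The length of the `A`-module `Ext^j_A(N / I^(n+1) N, M)`, possibly infinite. -/
noncomputable def extLength (A : Type u) [CommRing A]
    (N : Type u) [AddCommGroup N] [Module A N] (M : Type u) [AddCommGroup M] [Module A M]
    (I : Ideal A) (j n : ℕ) : ℕ∞ :=
  Module.length A
    (Ext (ModuleCat.of A (N ⧸ (I ^ (n + 1) • ⊤ : Submodule A N))) (ModuleCat.of A M) j)

/-! Let k be the residue field and r the largest degree with Ext^r(k, A) ≠ 0. Finite injective
dimension of A makes r exist, and Ext^i(-, A) vanishes on all finitely generated modules for i > r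
(`exists_selfExtVanishesAbove`). Moreover A has a regular sequence of length r, so r ≤ d, and for T
of finite length Ext^i(T, A) = 0 for i < r while ℓ(Ext^r(T, A)) = ℓ(T) · ℓ(Ext^r(k, A))
(`selfExt_of_isFiniteLength`).

A maximal Cohen-Macaulay M has Ext^i(M, A) = 0 for i > 0, hence is reflexive: M ≅ G* with G = M*.
Freeness on the punctured spectrum makes Tor_1(D, G) of finite length for every finitely generated
D, and then Ext^(r+1)(D, G*) ≅ Ext^r(Tor_1(D, G), A). Replacing G by its syzygies reaches every
degree j > r. So ℓ(Ext^j(D, M)) is a fixed constant times the length of ker(D ⊗ K → D ⊗ F), for a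
map K → F depending only on M and j (`exists_length_ext_eq_length_ker_mul`).

For D = N/I^n N let X = N ⊗ K, E = N ⊗ F, and let Z and C be the kernel and the image of X → E. The
length in question is ℓ(Z/(Z ∩ I^n X)) + ℓ((C ∩ I^n E)/I^n C) (`length_ker_lTensor_quotient`). The
first term is eventually constant because Z has finite length. The second is the Hilbert function of
a graded subquotient of the Rees module ⨁ I^n E, hence eventually polynomial
(`exists_hilbert_polynomial`). By Artin-Rees it is bounded by a constant times the minimal number of
generators of I^j, with n = k + j, and the sums of these numbers grow at most like n^(d+1), since
quotients of the Rees algebra have dimension at most d + 1 (`exists_sum_spanFinrank_pow_le`). This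
bounds the degree by d. -/

/-! ### Functoriality and long exact sequences of Ext in the first variable. -/

/-- The map `Ext^i(Y, L) → Ext^i(X, L)` induced by a linear map `X → Y`. -/
noncomputable def extPrecomp {A : Type u} [CommRing A] {X Y : Type u} [AddCommGroup X] [Module A X]
    [AddCommGroup Y] [Module A Y] (f : X →ₗ[A] Y) (L : ModuleCat.{u} A) (i : ℕ) :
    Ext (ModuleCat.of A Y) L i →ₗ[A] Ext (ModuleCat.of A X) L i :=
  (Ext.mk₀ (ModuleCat.ofHom f)).precompOfLinear A L (zero_add i)

section

variable {A : Type u} [CommRing A] {X Y Z : Type u} [AddCommGroup X] [Module A X]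
  [AddCommGroup Y] [Module A Y] [AddCommGroup Z] [Module A Z] (L : ModuleCat.{u} A)

lemma extPrecomp_apply (f : X →ₗ[A] Y) (i : ℕ) (x : Ext (ModuleCat.of A Y) L i) :
    extPrecomp f L i x = (Ext.mk₀ (ModuleCat.ofHom f)).comp x (zero_add i) := rfl

lemma extPrecomp_comp (f : X →ₗ[A] Y) (g : Y →ₗ[A] Z) (i : ℕ) :
    extPrecomp (g ∘ₗ f) L i = extPrecomp f L i ∘ₗ extPrecomp g L i := by
  ext x
  simp only [LinearMap.comp_apply, extPrecomp_apply]
  rw [Ext.mk₀_comp_mk₀_assoc]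
  rfl

lemma extPrecomp_id (i : ℕ) : extPrecomp (LinearMap.id : X →ₗ[A] X) L i = LinearMap.id := by
  ext x
  exact Ext.mk₀_id_comp x

lemma extPrecomp_lsmul (a : A) (i : ℕ) :
    extPrecomp (a • LinearMap.id : X →ₗ[A] X) L i = a • LinearMap.id := by
  ext x
  have : ModuleCat.ofHom (a • LinearMap.id : X →ₗ[A] X) = a • 𝟙 (ModuleCat.of A X) := rfl
  simp [extPrecomp_apply, this, Ext.mk₀_smul]

/-- A linear equivalence induces a linear equivalence on `Ext`. -/
noncomputable def extCongr (e : X ≃ₗ[A] Y) (i : ℕ) :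
    Ext (ModuleCat.of A Y) L i ≃ₗ[A] Ext (ModuleCat.of A X) L i :=
  LinearEquiv.ofLinearMap (extPrecomp e.toLinearMap L i) (extPrecomp e.symm.toLinearMap L i)
    (by rw [← extPrecomp_comp]; simp [extPrecomp_id])
    (by rw [← extPrecomp_comp]; simp [extPrecomp_id])

lemma ext_subsingleton_of_subsingleton [Subsingleton X] (i : ℕ) :
    Subsingleton (Ext (ModuleCat.of A X) L i) := by
  have h : (LinearMap.id : X →ₗ[A] X) = (0 : A) • LinearMap.id := Subsingleton.elim _ _
  have h' := extPrecomp_id (X := X) L i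
  rw [h, extPrecomp_lsmul, zero_smul] at h'
  exact ⟨fun x y ↦ by
    rw [← LinearMap.id_apply (R := A) x, ← LinearMap.id_apply (R := A) y, ← h']; rfl⟩

lemma ext_subsingleton_of_projective [Module.Projective A X] (i : ℕ) :
    Subsingleton (Ext (ModuleCat.of A X) L (i + 1)) :=
  Ext.subsingleton_of_projective _ _ _

variable {f : X →ₗ[A] Y} {g : Y →ₗ[A] Z}

lemma shortExact_of_exact (hf : Function.Injective f) (hg : Function.Surjective g)
    (h : Function.Exact f g) :
    (ModuleCat.shortComplexOfCompEqZero f g h.linearMap_comp_eq_zero).ShortExact :=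
  ModuleCat.shortComplex_shortExact _ h hf hg

lemma extPrecomp_exact (hf : Function.Injective f) (hg : Function.Surjective g)
    (h : Function.Exact f g) (i : ℕ) :
    Function.Exact (extPrecomp g L i) (extPrecomp f L i) := by
  intro x
  constructor
  · intro hx
    exact Ext.contravariant_sequence_exact₂ (shortExact_of_exact hf hg h) L x hx
  · rintro ⟨y, rfl⟩
    rw [← LinearMap.comp_apply, ← extPrecomp_comp, h.linearMap_comp_eq_zero]
    simp [extPrecomp_apply]

/-- The connecting map of the contravariant long exact sequence of `Ext`. -/
lemma exists_ext_connecting (hf : Function.Injective f) (hg : Function.Surjective g)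
    (h : Function.Exact f g) (i : ℕ) :
    ∃ δ : Ext (ModuleCat.of A X) L i →ₗ[A] Ext (ModuleCat.of A Z) L (i + 1),
      Function.Exact (extPrecomp f L i) δ ∧ Function.Exact δ (extPrecomp g L (i + 1)) := by
  have S := shortExact_of_exact hf hg h
  refine ⟨S.extClass.precompOfLinear A L (add_comm 1 i), fun x ↦ ⟨fun hx ↦ ?_, ?_⟩,
    fun x ↦ ⟨fun hx ↦ ?_, ?_⟩⟩
  · exact Ext.contravariant_sequence_exact₁ S L x (add_comm 1 i) hx
  · rintro ⟨y, rfl⟩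
    exact S.extClass_comp_assoc (γ := y) (h := add_comm 1 i)
  · exact Ext.contravariant_sequence_exact₃ S L x hx (add_comm 1 i)
  · rintro ⟨y, rfl⟩
    exact S.comp_extClass_assoc y (add_comm 1 i)

lemma extPrecomp_zero_injective (hg : Function.Surjective g) :
    Function.Injective (extPrecomp g L 0) := by
  have : Epi (ModuleCat.ofHom g) := (ModuleCat.epi_iff_surjective _).2 hg
  exact Ext.precomp_mk₀_injective_of_epi L (ModuleCat.ofHom g)

/-- `Ext^(i-1)(X, L) = 0`, a condition that is void for `i = 0`. -/
def ExtPredVanishes (X : Type u) [AddCommGroup X] [Module A X] (L : ModuleCat.{u} A) (i : ℕ) :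
    Prop :=
  ∀ k, k + 1 = i → Subsingleton (Ext (ModuleCat.of A X) L k)

lemma extPrecomp_injective (hf : Function.Injective f) (hg : Function.Surjective g)
    (h : Function.Exact f g) (i : ℕ) (hX : ExtPredVanishes X L i) :
    Function.Injective (extPrecomp g L i) := by
  cases i with
  | zero => exact extPrecomp_zero_injective L hg
  | succ i =>
    obtain ⟨δ, -, hδ⟩ := exists_ext_connecting L hf hg h i
    have := hX i rfl
    rw [injective_iff_map_eq_zero]
    intro x hx
    obtain ⟨y, rfl⟩ := (hδ x).1 hx
    rw [Subsingleton.elim y 0, map_zero]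

lemma extPrecomp_surjective (hf : Function.Injective f) (hg : Function.Surjective g)
    (h : Function.Exact f g) (i : ℕ) (hZ : Subsingleton (Ext (ModuleCat.of A Z) L (i + 1))) :
    Function.Surjective (extPrecomp f L i) := by
  obtain ⟨δ, hδ, -⟩ := exists_ext_connecting L hf hg h i
  exact fun x ↦ (hδ x).1 (Subsingleton.elim _ _)

lemma ext_subsingleton_middle (hf : Function.Injective f) (hg : Function.Surjective g)
    (h : Function.Exact f g) (i : ℕ) (hX : Subsingleton (Ext (ModuleCat.of A X) L i))
    (hZ : Subsingleton (Ext (ModuleCat.of A Z) L i)) :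
    Subsingleton (Ext (ModuleCat.of A Y) L i) := by
  refine subsingleton_of_forall_eq 0 fun x ↦ ?_
  obtain ⟨y, rfl⟩ := (extPrecomp_exact L hf hg h i x).1 (Subsingleton.elim _ _)
  rw [Subsingleton.elim y 0, map_zero]

lemma ext_subsingleton_left (hf : Function.Injective f) (hg : Function.Surjective g)
    (h : Function.Exact f g) (i : ℕ) (hY : Subsingleton (Ext (ModuleCat.of A Y) L i))
    (hZ : Subsingleton (Ext (ModuleCat.of A Z) L (i + 1))) :
    Subsingleton (Ext (ModuleCat.of A X) L i) :=
  (extPrecomp_surjective L hf hg h i hZ).subsingleton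

lemma ext_subsingleton_right (hf : Function.Injective f) (hg : Function.Surjective g)
    (h : Function.Exact f g) (i : ℕ) (hX : ExtPredVanishes X L i)
    (hY : Subsingleton (Ext (ModuleCat.of A Y) L i)) :
    Subsingleton (Ext (ModuleCat.of A Z) L i) :=
  (extPrecomp_injective L hf hg h i hX).subsingleton

lemma nonempty_ext_equiv_connecting (hf : Function.Injective f) (hg : Function.Surjective g)
    (h : Function.Exact f g) (i : ℕ) (hY : Subsingleton (Ext (ModuleCat.of A Y) L i))
    (hY' : Subsingleton (Ext (ModuleCat.of A Y) L (i + 1))) :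
    Nonempty (Ext (ModuleCat.of A X) L i ≃ₗ[A] Ext (ModuleCat.of A Z) L (i + 1)) := by
  obtain ⟨δ, hδ, hδ'⟩ := exists_ext_connecting L hf hg h i
  refine ⟨LinearEquiv.ofBijective δ ⟨?_, fun x ↦ (hδ' x).1 (Subsingleton.elim _ _)⟩⟩
  rw [injective_iff_map_eq_zero]
  intro x hx
  obtain ⟨y, rfl⟩ := (hδ x).1 hx
  rw [Subsingleton.elim y 0, map_zero]

lemma extPrecomp_bijective_right (hf : Function.Injective f) (hg : Function.Surjective g)
    (h : Function.Exact f g) (i : ℕ) (hX : ExtPredVanishes X L i)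
    (hX' : Subsingleton (Ext (ModuleCat.of A X) L i)) :
    Function.Bijective (extPrecomp g L i) :=
  ⟨extPrecomp_injective L hf hg h i hX,
    fun x ↦ (extPrecomp_exact L hf hg h i x).1 (Subsingleton.elim _ _)⟩

lemma extPrecomp_bijective_left (hf : Function.Injective f) (hg : Function.Surjective g)
    (h : Function.Exact f g) (i : ℕ) (hZ : Subsingleton (Ext (ModuleCat.of A Z) L i))
    (hZ' : Subsingleton (Ext (ModuleCat.of A Z) L (i + 1))) :
    Function.Bijective (extPrecomp f L i) := by
  refine ⟨?_, extPrecomp_surjective L hf hg h i hZ'⟩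
  rw [injective_iff_map_eq_zero]
  intro x hx
  obtain ⟨y, rfl⟩ := (extPrecomp_exact L hf hg h i x).1 hx
  rw [Subsingleton.elim y 0, map_zero]

/-- If `a` annihilates `X`, it annihilates `Ext^i(X, L)`. -/
lemma smul_ext_eq_zero {a : A} (ha : ∀ x : X, a • x = 0) (i : ℕ)
    (x : Ext (ModuleCat.of A X) L i) : a • x = 0 := by
  have h : (a • LinearMap.id : X →ₗ[A] X) = 0 := by ext; simp [ha]
  have h' := extPrecomp_lsmul (X := X) L a i
  have : extPrecomp (0 : X →ₗ[A] X) L i x = 0 := by simp [extPrecomp_apply]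
  rw [← h, h'] at this
  exact this

lemma ext_zero_nontrivial [Nontrivial X] {Y' : Type u} [AddCommGroup Y'] [Module A Y']
    (f : X →ₗ[A] Y') (hf : f ≠ 0) : Nontrivial (Ext (ModuleCat.of A X) (ModuleCat.of A Y') 0) := by
  refine ⟨Ext.mk₀ (ModuleCat.ofHom f), 0, fun h ↦ hf ?_⟩
  rw [Ext.mk₀_eq_zero_iff] at h
  simpa using congrArg ModuleCat.Hom.hom h

end

/-! ### Finite length and Nakayama over a local ring. -/

section FiniteLength

open IsLocalRing

lemma length_quotient_maximalIdeal (A : Type u) [CommRing A] [IsLocalRing A] :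
    Module.length A (A ⧸ maximalIdeal A) = 1 := by
  have : IsSimpleModule A (A ⧸ maximalIdeal A) :=
    isSimpleModule_iff_isCoatom.2 (Ideal.isMaximal_def.1 (maximalIdeal.isMaximal A))
  exact Module.length_eq_one A _

lemma IsSimpleModule.nonempty_equiv_quotient_maximalIdeal {A : Type u} [CommRing A] [IsLocalRing A]
    (T : Type u) [AddCommGroup T] [Module A T] [IsSimpleModule A T] :
    Nonempty (T ≃ₗ[A] A ⧸ maximalIdeal A) := by
  obtain ⟨I, hI, ⟨e⟩⟩ := isSimpleModule_iff_quot_maximal.1 ‹IsSimpleModule A T›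
  obtain rfl := eq_maximalIdeal hI
  exact ⟨e⟩

/-- Dévissage along a prime filtration: a factor A/p killed by a power of the maximal ideal has p
maximal, hence length one. -/
lemma length_ne_top_of_maximalIdeal_pow_le {A : Type u} [CommRing A] [IsNoetherianRing A]
    [IsLocalRing A] (T : Type*) [AddCommGroup T] [Module A T] (hT : Module.Finite A T)
    (k : ℕ) (hk : maximalIdeal A ^ k ≤ Module.annihilator A T) : Module.length A T ≠ ⊤ := by
  induction hT using IsNoetherianRing.induction_on_isQuotientEquivQuotientPrime A with
  | subsingleton N => simp [Module.length_eq_zero]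
  | quotient N p e =>
    rw [e.annihilator_eq, Ideal.annihilator_quotient] at hk
    have h := Ideal.IsPrime.le_of_pow_le hk
    have hp : p.asIdeal = maximalIdeal A :=
      le_antisymm (le_maximalIdeal p.isPrime.ne_top) h
    rw [e.length_eq, hp, length_quotient_maximalIdeal]
    exact ENat.one_ne_top
  | exact N₁ N₂ N₃ f g hf hg hfg h₁ h₃ =>
    rw [Module.length_eq_add_of_exact f g hf hg hfg]
    exact WithTop.add_ne_top.2 ⟨h₁ (hk.trans (f.annihilator_le_of_injective hf)),
      h₃ (hk.trans (g.annihilator_le_of_surjective hg))⟩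

lemma subsingleton_of_smul_surjective {A : Type u} [CommRing A] [IsLocalRing A] {E : Type*}
    [AddCommGroup E] [Module A E] [Module.Finite A E] {a : A} (ha : a ∈ maximalIdeal A)
    (h : ∀ e : E, ∃ e' : E, a • e' = e) : Subsingleton E := by
  rw [← Submodule.subsingleton_iff A, ← subsingleton_iff_bot_eq_top, eq_comm]
  refine Submodule.eq_bot_of_le_smul_of_le_jacobson_bot (maximalIdeal A) ⊤ Module.Finite.fg_top ?_
    (maximalIdeal_le_jacobson _)
  intro e _
  obtain ⟨e', rfl⟩ := h e
  exact Submodule.smul_mem_smul ha trivial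

end FiniteLength

/-! ### Notation for Ext into the ring. -/

section SelfExt

variable {A : Type u} [CommRing A]

/-- The `A`-module `Ext^i_A(X, A)`. -/
abbrev SelfExt (A : Type u) [CommRing A] (X : Type u) [AddCommGroup X] [Module A X] (i : ℕ) :
    Type u :=
  Ext (ModuleCat.of A X) (ModuleCat.of A A) i

lemma selfExt_zero_nontrivial [Nontrivial A] : Nontrivial (SelfExt A A 0) :=
  ext_zero_nontrivial LinearMap.id (by
    intro h
    exact one_ne_zero (congrArg (fun f : A →ₗ[A] A ↦ f 1) h))

lemma lsmul_injective_of_isSMulRegular {X : Type u} [AddCommGroup X] [Module A X] {a : A}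
    (h : IsSMulRegular X a) :
    Function.Injective (a • LinearMap.id : X →ₗ[A] X) := h

open Pointwise in
lemma lsmul_exact (X : Type u) [AddCommGroup X] [Module A X] (a : A) :
    Function.Exact (a • LinearMap.id : X →ₗ[A] X) (a • (⊤ : Submodule A X)).mkQ :=
  LinearMap.exact_lsmul_mkQ_smul_top X a

end SelfExt

/-! ### Ext into a Gorenstein ring: vanishing, depth, finite length modules. -/

section Gorenstein

open IsLocalRing RingTheory.Sequence

variable {A : Type u} [CommRing A] [IsNoetherianRing A] [IsLocalRing A]

/-- `Ext^i(-, A)` vanishes on finitely generated modules for `i > r`. -/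
def SelfExtVanishesAbove (A : Type u) [CommRing A] (r : ℕ) : Prop :=
  ∀ (X : Type u) [AddCommGroup X] [Module A X] [Module.Finite A X] (i : ℕ), r < i →
    Subsingleton (SelfExt A X i)

/-- In the long exact sequence of 0 → X → X → X/aX → 0 the hypothesis makes multiplication by `a`
surjective on Ext^i(X, L), which is finitely generated; Nakayama concludes. -/
lemma ext_subsingleton_of_quotSMulTop {X : Type u} [AddCommGroup X] [Module A X]
    [Module.Finite A X] {a : A} (ha : a ∈ maximalIdeal A) (hX : IsSMulRegular X a)
    (L : ModuleCat.{u} A) [Module.Finite A L] (i : ℕ)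
    (h : Subsingleton (Ext (ModuleCat.of A (QuotSMulTop a X)) L (i + 1))) :
    Subsingleton (Ext (ModuleCat.of A X) L i) := by
  refine subsingleton_of_smul_surjective ha fun e ↦ ?_
  obtain ⟨e', he⟩ := extPrecomp_surjective L (lsmul_injective_of_isSMulRegular hX)
    (Submodule.mkQ_surjective _) (lsmul_exact X a) i h e
  rw [extPrecomp_lsmul] at he
  exact ⟨e', he⟩

/-- Each element of the regular sequence lowers the vanishing threshold by one. A sequence of length
at least r kills all positive degrees, which is how the Cohen-Macaulay hypothesis enters. -/
lemma SelfExtVanishesAbove.of_isWeaklyRegular {r : ℕ} (hr : SelfExtVanishesAbove A r)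
    (rs : List A) (hrs : ∀ a ∈ rs, a ∈ maximalIdeal A) (X : Type u) [AddCommGroup X] [Module A X]
    [Module.Finite A X] (h : IsWeaklyRegular X rs) (i : ℕ) (hi : r < i + rs.length) :
    Subsingleton (SelfExt A X i) := by
  induction rs generalizing X i with
  | nil => exact hr X i hi
  | cons a rs ih =>
    rw [isWeaklyRegular_cons_iff] at h
    refine ext_subsingleton_of_quotSMulTop (hrs a (by simp)) h.1 _ i ?_
    exact ih (fun b hb ↦ hrs b (by simp [hb])) _ h.2 (i + 1) (by simp at hi; omega)

omit [IsNoetherianRing A] in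
-- The first element `a` acts as zero on Ext(k, L), so the sequence of 0 → L → L → L/aL → 0 exhibits
-- Ext^(i+1)(k, L) as a quotient of Ext^i(k, L/aL).
lemma ext_residue_subsingleton_of_isWeaklyRegular (rs : List A)
    (hrs : ∀ a ∈ rs, a ∈ maximalIdeal A) (L : Type u) [AddCommGroup L] [Module A L]
    (h : IsWeaklyRegular L rs) (i : ℕ) (hi : i < rs.length) :
    Subsingleton (Ext (ModuleCat.of A (A ⧸ maximalIdeal A)) (ModuleCat.of A L) i) := by
  induction rs generalizing L i with
  | nil => simp at hi
  | cons a rs ih =>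
    rw [isWeaklyRegular_cons_iff] at h
    have S : (ModuleCat.smulShortComplex (ModuleCat.of A L) a).ShortExact :=
      IsSMulRegular.smulShortComplex_shortExact h.1
    have ha : ∀ x : A ⧸ maximalIdeal A, a • x = 0 := by
      intro x
      obtain ⟨x, rfl⟩ := Ideal.Quotient.mk_surjective x
      rw [← Ideal.Quotient.mk_eq_mk, ← Submodule.Quotient.mk_smul, Submodule.Quotient.mk_eq_zero]
      exact Ideal.mul_mem_right _ _ (hrs a (by simp))
    have h0 (x : Ext (ModuleCat.of A (A ⧸ maximalIdeal A)) (ModuleCat.of A L) i) :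
        x.comp (Ext.mk₀ (ModuleCat.smulShortComplex (ModuleCat.of A L) a).f) (add_zero i) = 0 := by
      exact (Ext.smul_eq_comp_mk₀ x a).symm.trans (smul_ext_eq_zero _ ha i x)
    refine subsingleton_of_forall_eq 0 fun x ↦ ?_
    cases i with
    | zero =>
      have := S.mono_f
      exact Ext.postcomp_mk₀_injective_of_mono _
        (ModuleCat.smulShortComplex (ModuleCat.of A L) a).f ((h0 x).trans (map_zero _).symm)
    | succ i =>
      obtain ⟨y, rfl⟩ := Ext.covariant_sequence_exact₁ _ S x (h0 x) rfl
      have := ih (fun b hb ↦ hrs b (by simp [hb])) _ h.2 i (by simpa using hi)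
      have hy : y = 0 := this.elim _ _
      rw [hy]
      exact Ext.zero_comp (ModuleCat.of A (A ⧸ maximalIdeal A)) i S.extClass _ rfl

/-- Dévissage to A/p. For p not maximal, an element of the maximal ideal outside p is regular on
A/p, so the vanishing in degree r + 1 already forces it in degree r; only the residue field needs a
hypothesis. -/
lemma selfExt_subsingleton_of_residue {r : ℕ} (hr : SelfExtVanishesAbove A r)
    (hk : Subsingleton (SelfExt A (A ⧸ maximalIdeal A) r)) (X : Type u) [AddCommGroup X]
    [Module A X] (hX : Module.Finite A X) : Subsingleton (SelfExt A X r) := by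
  induction hX using IsNoetherianRing.induction_on_isQuotientEquivQuotientPrime A with
  | subsingleton N => exact ext_subsingleton_of_subsingleton _ _
  | quotient N p e =>
    by_cases hp : p.asIdeal = maximalIdeal A
    · rw [hp] at e
      exact (extCongr (ModuleCat.of A A) e r).symm.toEquiv.subsingleton
    · obtain ⟨a, ha, hap⟩ := SetLike.exists_of_lt
        (lt_of_le_of_ne (le_maximalIdeal p.isPrime.ne_top) hp)
      have hreg : IsSMulRegular N a := by
        rw [e.isSMulRegular_congr, isSMulRegular_quotient_iff_mem_of_smul_mem]
        intro x hx
        exact (p.isPrime.mem_or_mem hx).resolve_left hap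
      exact ext_subsingleton_of_quotSMulTop ha hreg _ r (hr _ _ (Nat.lt_succ_self r))
  | exact N₁ N₂ N₃ f g hf hg hfg h₁ h₃ => exact ext_subsingleton_middle _ hf hg hfg r h₁ h₃

/-- Take the least threshold r: if Ext^r(k, A) were zero, the previous lemma would lower it. -/
lemma exists_selfExtVanishesAbove (hA : IsGorensteinLocalRing A) :
    ∃ r, SelfExtVanishesAbove A r ∧ Nontrivial (SelfExt A (A ⧸ maximalIdeal A) r) := by
  classical
  have hex : ∃ r, SelfExtVanishesAbove A r := by
    obtain ⟨n, hn⟩ := hA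
    exact ⟨n, fun X _ _ _ i hi ↦ HasInjectiveDimensionLT.subsingleton _ (n + 1) i hi _⟩
  refine ⟨Nat.find hex, Nat.find_spec hex, ?_⟩
  by_contra hk
  rw [not_nontrivial_iff_subsingleton] at hk
  have hall := fun (X : Type u) [AddCommGroup X] [Module A X] (hX : Module.Finite A X) ↦
    selfExt_subsingleton_of_residue (Nat.find_spec hex) hk X hX
  rcases hr : Nat.find hex with _ | r
  -- A threshold of zero cannot be lowered; here Hom(A, A) ≠ 0 gives the contradiction.
  · have h1 := hall A inferInstance
    rw [hr] at h1
    exact not_subsingleton_iff_nontrivial.2 selfExt_zero_nontrivial h1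
  · refine Nat.find_min hex (m := r) (by omega) fun X _ _ _ i hi ↦ ?_
    rcases Nat.lt_or_ge (r + 1) i with h | h
    · exact Nat.find_spec hex X i (by omega)
    · obtain rfl : i = r + 1 := by omega
      have := hall X inferInstance
      rwa [hr] at this

lemma exists_isSMulRegular_or_exists_injective (X : Type u) [AddCommGroup X] [Module A X]
    [Module.Finite A X] :
    (∃ a ∈ maximalIdeal A, IsSMulRegular X a) ∨
      ∃ f : (A ⧸ maximalIdeal A) →ₗ[A] X, Function.Injective f := by
  by_cases h : Subsingleton ((A ⧸ maximalIdeal A) →ₗ[A] X)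
  · left
    rw [IsSMulRegular.subsingleton_linearMap_iff, Ideal.annihilator_quotient] at h
    exact h
  · right
    rw [not_subsingleton_iff_nontrivial] at h
    obtain ⟨f, hf⟩ := exists_ne (0 : (A ⧸ maximalIdeal A) →ₗ[A] X)
    have : IsSimpleModule A (A ⧸ maximalIdeal A) :=
      isSimpleModule_iff_isCoatom.2 (Ideal.isMaximal_def.1 (maximalIdeal.isMaximal A))
    exact ⟨f, (LinearMap.injective_or_eq_zero f).resolve_right hf⟩

/-- Noetherian induction over the quotients Z of X. If k embeds in Z, then Ext^r(Z, A) surjects onto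
Ext^r(k, A) ≠ 0, since Ext^(r+1) of the cokernel vanishes. Otherwise some `a` is regular on Z; the
induction gives Ext^i(Z/aZ, A) ≠ 0, and since Ext^i(Z, A) = 0 this class comes from Ext^(i-1)(Z, A).
For X = A only i = 0 is possible, so A has a regular sequence of length r. -/
lemma exists_isWeaklyRegular_selfExt_nontrivial {r : ℕ} (hr : SelfExtVanishesAbove A r)
    (hk : Nontrivial (SelfExt A (A ⧸ maximalIdeal A) r)) (X : Type u) [AddCommGroup X]
    [Module A X] [Module.Finite A X] [Nontrivial X] :
    ∃ (rs : List A) (i : ℕ), (∀ a ∈ rs, a ∈ maximalIdeal A) ∧ IsWeaklyRegular X rs ∧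
      i + rs.length = r ∧ Nontrivial (SelfExt A X i) := by
  suffices H : ∀ (W : Submodule A X) (Z : Type u) [AddCommGroup Z] [Module A Z] [Nontrivial Z]
      (f : X →ₗ[A] Z), Function.Surjective f → LinearMap.ker f = W →
      ∃ (rs : List A) (i : ℕ), (∀ a ∈ rs, a ∈ maximalIdeal A) ∧ IsWeaklyRegular Z rs ∧
      i + rs.length = r ∧ Nontrivial (SelfExt A Z i) from
    H _ X LinearMap.id Function.surjective_id rfl
  intro W
  induction W using WellFoundedGT.induction with
  | _ W ih =>
  intro Z _ _ _ f hf hW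
  have : Module.Finite A Z := Module.Finite.of_surjective f hf
  rcases exists_isSMulRegular_or_exists_injective (A := A) Z with ⟨a, ha, hreg⟩ | ⟨φ, hφ⟩
  · have := nontrivial_quotSMulTop_of_mem_maximalIdeal Z ha
    let q : Z →ₗ[A] QuotSMulTop a Z := Submodule.mkQ _
    obtain ⟨z, hz⟩ := exists_ne (0 : Z)
    obtain ⟨x, hx⟩ := hf (a • z)
    -- The kernel grows strictly: a preimage of `a • z` with `z ≠ 0` dies in Z/aZ but not in Z, as
    -- `a` is regular.
    have hlt : W < LinearMap.ker (q ∘ₗ f) := by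
      rw [← hW]
      refine SetLike.lt_iff_le_and_exists.2 ⟨LinearMap.ker_le_ker_comp f q, x, ?_, ?_⟩
      · rw [LinearMap.mem_ker, LinearMap.comp_apply, hx]
        exact (lsmul_exact Z a (a • z)).2 ⟨z, rfl⟩
      · rw [LinearMap.mem_ker, hx]
        exact fun h ↦ hz (hreg (h.trans (smul_zero a).symm))
    obtain ⟨rs, i, hrs, hw, hi, hnt⟩ := ih _ hlt (QuotSMulTop a Z) (q ∘ₗ f)
      ((Submodule.mkQ_surjective _).comp hf) rfl
    have h0 : Subsingleton (SelfExt A Z i) :=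
      ext_subsingleton_of_quotSMulTop ha hreg _ i
        (hr.of_isWeaklyRegular rs hrs _ hw (i + 1) (by omega))
    by_contra! hcon
    refine not_subsingleton_iff_nontrivial.2 hnt (ext_subsingleton_right _
      (lsmul_injective_of_isSMulRegular hreg) (Submodule.mkQ_surjective _) (lsmul_exact Z a) i
      ?_ h0)
    intro k hki
    refine hcon (a :: rs) k ?_ ?_ ?_
    · simpa using ⟨ha, hrs⟩
    · exact (isWeaklyRegular_cons_iff _ _ _).2 ⟨hreg, hw⟩
    · simp; omega
  · refine ⟨[], r, by simp, IsWeaklyRegular.nil A Z, by simp, ?_⟩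
    by_contra hcon
    rw [not_nontrivial_iff_subsingleton] at hcon
    exact not_subsingleton_iff_nontrivial.2 hk (ext_subsingleton_left _ hφ
      (Submodule.mkQ_surjective _) (LinearMap.exact_map_mkQ_range φ) r hcon
      (hr _ _ (Nat.lt_succ_self r)))

lemma exists_isWeaklyRegular_self {r : ℕ} (hr : SelfExtVanishesAbove A r)
    (hk : Nontrivial (SelfExt A (A ⧸ maximalIdeal A) r)) :
    ∃ rs : List A, (∀ a ∈ rs, a ∈ maximalIdeal A) ∧ IsWeaklyRegular A rs ∧ rs.length = r := by
  obtain ⟨rs, i, hrs, hw, hi, hnt⟩ := exists_isWeaklyRegular_selfExt_nontrivial hr hk A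
  cases i with
  | zero => exact ⟨rs, hrs, hw, by omega⟩
  | succ i =>
    exact (not_subsingleton_iff_nontrivial.2 hnt (ext_subsingleton_of_projective _ i)).elim

/-- A regular sequence of length r lowers the Krull dimension by exactly r. Equality of r and d is
never needed. -/
lemma le_of_selfExt_residue_nontrivial {r d : ℕ} (hr : SelfExtVanishesAbove A r)
    (hk : Nontrivial (SelfExt A (A ⧸ maximalIdeal A) r))
    (hd : ringKrullDim A = (d : WithBot ℕ∞)) : r ≤ d := by
  obtain ⟨rs, hrs, hw, rfl⟩ := exists_isWeaklyRegular_self hr hk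
  have hreg : IsRegular A rs := IsRegular.of_isWeaklyRegular_of_mem_maximalIdeal A hrs hw
  have h := ringKrullDim_add_length_eq_ringKrullDim_of_isRegular rs hreg
  have hnt : Nontrivial (A ⧸ Ideal.ofList rs) :=
    Ideal.Quotient.nontrivial_iff.2 (ne_top_of_le_ne_top (maximalIdeal.isMaximal A).ne_top
      (Ideal.span_le.2 hrs))
  have h0 := ringKrullDim_nonneg_of_nontrivial (R := A ⧸ Ideal.ofList rs)
  rw [hd] at h
  have : ((rs.length : ℕ) : WithBot ℕ∞) ≤ d := by
    rw [← h]
    exact le_add_of_nonneg_left h0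
  exact_mod_cast this

/-- The multiplicity factor relating `ℓ(Ext^r(T, A))` and `ℓ(T)`. -/
lemma selfExt_of_isFiniteLength {r : ℕ} (hr : SelfExtVanishesAbove A r)
    (hk : Nontrivial (SelfExt A (A ⧸ maximalIdeal A) r)) (T : Type u) [AddCommGroup T]
    [Module A T] (hT : IsFiniteLength A T) :
    (∀ i < r, Subsingleton (SelfExt A T i)) ∧
      Module.length A (SelfExt A T r) =
        Module.length A T * Module.length A (SelfExt A (A ⧸ maximalIdeal A) r) := by
  obtain ⟨rs, hrs, hw, hlen⟩ := exists_isWeaklyRegular_self hr hk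
  induction hT with
  | of_subsingleton =>
    exact ⟨fun i _ ↦ ext_subsingleton_of_subsingleton _ _, by
      simp [Module.length_eq_zero_iff.2 (ext_subsingleton_of_subsingleton _ r),
        Module.length_eq_zero]⟩
  | @of_simple_quotient M _ _ N _ hN ih =>
    obtain ⟨e⟩ := IsSimpleModule.nonempty_equiv_quotient_maximalIdeal (A := A) (M ⧸ N)
    have hlow (i : ℕ) (hi : i < r) : Subsingleton (SelfExt A (M ⧸ N) i) :=
      have := ext_residue_subsingleton_of_isWeaklyRegular rs hrs A hw i (hlen ▸ hi)
      (extCongr (ModuleCat.of A A) e i).symm.toEquiv.subsingleton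
    refine ⟨fun i hi ↦ ext_subsingleton_middle _ (Submodule.injective_subtype N)
      (Submodule.mkQ_surjective _) (LinearMap.exact_subtype_mkQ _) i (ih.1 i hi) (hlow i hi), ?_⟩
    have hfin : Module.Finite A (M ⧸ N) := Module.Finite.equiv e.symm
    -- Ext^(r-1) of the submodule and Ext^(r+1) of the simple quotient vanish, so the degree r part
    -- of the long sequence is short exact and lengths add.
    rw [Module.length_eq_add_of_exact _ _
      (extPrecomp_injective (ModuleCat.of A A) (Submodule.injective_subtype N)
        (Submodule.mkQ_surjective _) (LinearMap.exact_subtype_mkQ _) r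
        fun k hk ↦ ih.1 k (by omega))
      (extPrecomp_surjective (ModuleCat.of A A) (Submodule.injective_subtype N)
        (Submodule.mkQ_surjective _) (LinearMap.exact_subtype_mkQ _) r (hr _ _ (by omega)))
      (extPrecomp_exact (ModuleCat.of A A) (Submodule.injective_subtype N)
        (Submodule.mkQ_surjective _) (LinearMap.exact_subtype_mkQ _) r),
      Module.length_eq_add_of_exact _ _ (Submodule.injective_subtype N)
        (Submodule.mkQ_surjective _) (LinearMap.exact_subtype_mkQ _), ih.2,
      ← (extCongr (ModuleCat.of A A) e r).length_eq, e.length_eq, length_quotient_maximalIdeal,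
      add_mul, one_mul, add_comm]

lemma length_selfExt_residue_ne_top (r : ℕ) :
    Module.length A (SelfExt A (A ⧸ maximalIdeal A) r) ≠ ⊤ := by
  refine length_ne_top_of_maximalIdeal_pow_le _ (ModuleCat.finite_ext A _ _ r) 1 fun a ha ↦ ?_
  rw [pow_one] at ha
  refine Module.mem_annihilator.2 fun x ↦ smul_ext_eq_zero _ (fun y ↦ ?_) r x
  have : a ∈ Module.annihilator A (A ⧸ maximalIdeal A) := by rwa [Ideal.annihilator_quotient]
  exact Module.mem_annihilator.1 this y

end Gorenstein

/-! ### Multiplications that factor through free modules. -/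

section StableAnnihilator

/-- Multiplication by `a` on `G` factors through a finite free module. -/
def FactorsThroughFree {A : Type u} [CommRing A] (a : A) (G : Type u) [AddCommGroup G]
    [Module A G] : Prop :=
  ∃ (P : Type u) (_ : AddCommGroup P) (_ : Module A P) (_ : Module.Free A P)
    (_ : Module.Finite A P) (ι : G →ₗ[A] P) (ρ : P →ₗ[A] G), ρ ∘ₗ ι = a • LinearMap.id

variable {A : Type u} [CommRing A] {G : Type u} [AddCommGroup G] [Module A G]

lemma FactorsThroughFree.dual {a : A} (h : FactorsThroughFree a G) :
    FactorsThroughFree a (Module.Dual A G) := by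
  obtain ⟨P, _, _, _, _, ι, ρ, h⟩ := h
  refine ⟨Module.Dual A P, inferInstance, inferInstance, inferInstance, inferInstance,
    ρ.dualMap, ι.dualMap, ?_⟩
  ext f x
  have := congrArg f (LinearMap.congr_fun h x)
  simpa using this

lemma FactorsThroughFree.exists_section {a : A} (h : FactorsThroughFree a G) {F : Type u}
    [AddCommGroup F] [Module A F] {π : F →ₗ[A] G} (hπ : Function.Surjective π) :
    ∃ g : G →ₗ[A] F, π ∘ₗ g = a • LinearMap.id := by
  obtain ⟨P, _, _, _, _, ι, ρ, h⟩ := h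
  obtain ⟨σ, hσ⟩ := Module.projective_lifting_property π ρ hπ
  exact ⟨σ ∘ₗ ι, by rw [← LinearMap.comp_assoc, hσ, h]⟩

/-- If `π ∘ g = a`, then `a - g ∘ π` is killed by π, so it takes values in K, and on K it is
multiplication by `a`. -/
lemma FactorsThroughFree.exists_retraction {a : A} (h : FactorsThroughFree a G) {K F : Type u}
    [AddCommGroup K] [Module A K] [AddCommGroup F] [Module A F] {ι : K →ₗ[A] F} {π : F →ₗ[A] G}
    (hι : Function.Injective ι) (hπ : Function.Surjective π) (hex : Function.Exact ι π) :
    ∃ ρ : F →ₗ[A] K, ρ ∘ₗ ι = a • LinearMap.id := by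
  obtain ⟨g, hg⟩ := h.exists_section hπ
  let h' : F →ₗ[A] F := a • LinearMap.id - g ∘ₗ π
  have hmem (x : F) : h' x ∈ LinearMap.range ι := by
    rw [← hex.linearMap_ker_eq, LinearMap.mem_ker]
    have := LinearMap.congr_fun hg (π x)
    simp only [LinearMap.comp_apply, LinearMap.smul_apply, LinearMap.id_apply] at this
    simp [h', this]
  refine ⟨(LinearEquiv.ofInjective ι hι).symm.toLinearMap ∘ₗ h'.codRestrict _ hmem, ?_⟩
  ext x
  apply hι
  have h1 (y : LinearMap.range ι) : ι ((LinearEquiv.ofInjective ι hι).symm y) = y := by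
    conv_rhs => rw [← (LinearEquiv.ofInjective ι hι).apply_symm_apply y]
    rfl
  simp [h1, h', hex.apply_apply_eq_zero]

/-- Let J be the ideal of those `a` for which `a • id` lifts along a fixed free cover of G. At a
prime p other than the maximal ideal the localized cover splits; clearing denominators gives an
element of J outside p. Hence J contains a power of the maximal ideal. -/
lemma exists_pow_factorsThroughFree [IsLocalRing A] [IsNoetherianRing A] [Module.Finite A G]
    (h : IsFreeOnPuncturedSpectrum A G) :
    ∃ k : ℕ, ∀ a ∈ IsLocalRing.maximalIdeal A ^ k, FactorsThroughFree a G := by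
  obtain ⟨n, π, hπ⟩ := Module.Finite.exists_fin' A G
  let P := ULift.{u} (Fin n) → A
  let π' : P →ₗ[A] G := π ∘ₗ (LinearEquiv.funCongrLeft A A Equiv.ulift.symm).toLinearMap
  have hπ' : Function.Surjective π' := hπ.comp (LinearEquiv.surjective _)
  let J : Ideal A := (LinearMap.range (LinearMap.compRight A π' : (G →ₗ[A] P) →ₗ[A] _)).comap
    (LinearMap.toSpanSingleton A (G →ₗ[A] G) LinearMap.id)
  have hJ {a : A} : a ∈ J ↔ ∃ g : G →ₗ[A] P, π' ∘ₗ g = a • LinearMap.id := Iff.rfl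
  have hJp (p : Ideal A) (hp : p.IsPrime) (hpJ : J ≤ p) : p = IsLocalRing.maximalIdeal A := by
    by_contra hne
    have := h p hne
    obtain ⟨g, hg⟩ := Module.projective_lifting_property (LocalizedModule.map p.primeCompl π')
      (LinearMap.id : LocalizedModule p.primeCompl G →ₗ[Localization.AtPrime p] _)
      (LocalizedModule.map_surjective p.primeCompl π' hπ')
    have hfp : Module.FinitePresentation A G := Module.finitePresentation_of_finite A G
    -- The local section descends to A up to a denominator `s`; a second denominator `u` turns the
    -- equality after localization into one over A.
    obtain ⟨g', s, hs⟩ := Module.FinitePresentation.exists_lift_of_isLocalizedModule p.primeCompl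
      (LocalizedModule.mkLinearMap p.primeCompl P)
      ((g.restrictScalars A) ∘ₗ LocalizedModule.mkLinearMap p.primeCompl G)
    obtain ⟨u, hu⟩ := Module.Finite.exists_smul_of_comp_eq_of_isLocalizedModule p.primeCompl
      (LocalizedModule.mkLinearMap p.primeCompl G) (π' ∘ₗ g') (s • LinearMap.id) (by
        ext x
        have h1 := LinearMap.congr_fun hs x
        have h2 := LinearMap.congr_fun hg (LocalizedModule.mkLinearMap p.primeCompl G x)
        have h3 : LocalizedModule.mkLinearMap p.primeCompl G (π' (g' x)) =
          LocalizedModule.map p.primeCompl π' (LocalizedModule.mkLinearMap p.primeCompl P (g' x)) :=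
          by simp [LocalizedModule.mkLinearMap_apply, LocalizedModule.map_mk]
        simp only [LinearMap.comp_apply, LinearMap.smul_apply, LinearMap.id_apply] at h1 h2 ⊢
        rw [h3, h1, LinearMap.restrictScalars_apply, Submonoid.smul_def, Submonoid.smul_def,
          ← algebraMap_smul (Localization.AtPrime p), map_smul, h2, map_smul, algebraMap_smul])
    have hmem : (u * s : A) ∈ J := hJ.2 ⟨(u : A) • g', by
      rw [LinearMap.comp_smul, mul_smul]
      exact hu⟩
    exact (u * s).2 (hpJ hmem)
  have hrad : IsLocalRing.maximalIdeal A ≤ J.radical := by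
    rw [Ideal.radical_eq_sInf]
    refine le_sInf fun p hp ↦ (hJp p hp.2 hp.1).ge
  obtain ⟨k, hk⟩ := Ideal.exists_pow_le_of_le_radical_of_fg hrad (IsNoetherian.noetherian _)
  refine ⟨k, fun a ha ↦ ?_⟩
  obtain ⟨g, hg⟩ := hJ.1 (hk ha)
  exact ⟨P, inferInstance, inferInstance, inferInstance, inferInstance, g, π', hg⟩

end StableAnnihilator

/-! ### Duals and reflexivity of modules without higher Ext into A. -/

section Duality

variable {A : Type u} [CommRing A] {X Y Z : Type u} [AddCommGroup X] [Module A X]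
  [AddCommGroup Y] [Module A Y] [AddCommGroup Z] [Module A Z] {f : X →ₗ[A] Y} {g : Y →ₗ[A] Z}

lemma exists_extension_of_ext_one {L : Type u} [AddCommGroup L] [Module A L]
    (hf : Function.Injective f) (hg : Function.Surjective g) (h : Function.Exact f g)
    (hZ : Subsingleton (Ext (ModuleCat.of A Z) (ModuleCat.of A L) 1)) (φ : X →ₗ[A] L) :
    ∃ ψ : Y →ₗ[A] L, ψ ∘ₗ f = φ := by
  obtain ⟨y, hy⟩ := extPrecomp_surjective (ModuleCat.of A L) hf hg h 0 hZ
    (Ext.mk₀ (ModuleCat.ofHom φ))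
  obtain ⟨ψ, rfl⟩ := Ext.addEquiv₀.symm.surjective y
  refine ⟨ψ.hom, ?_⟩
  rw [extPrecomp_apply] at hy
  have hy' : Ext.mk₀ (ModuleCat.ofHom f ≫ ψ) = Ext.mk₀ (ModuleCat.ofHom φ) := by
    rw [← hy, ← Ext.mk₀_comp_mk₀]; rfl
  have := (Ext.mk₀_bijective _ _).1 hy'
  simpa using congrArg ModuleCat.Hom.hom this

lemma exists_factor_of_exact {L : Type u} [AddCommGroup L] [Module A L]
    (hg : Function.Surjective g) (h : Function.Exact f g) (φ : Y →ₗ[A] L) (hφ : φ ∘ₗ f = 0) :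
    ∃ ψ : Z →ₗ[A] L, ψ ∘ₗ g = φ := by
  refine ⟨(LinearMap.ker g).liftQ φ ?_ ∘ₗ (g.quotKerEquivOfSurjective hg).symm.toLinearMap, ?_⟩
  · rw [h.linearMap_ker_eq, LinearMap.range_le_ker_iff, hφ]
  · ext y
    have : (g.quotKerEquivOfSurjective hg).symm (g y) = Submodule.Quotient.mk y := by
      rw [LinearEquiv.symm_apply_eq]; rfl
    simp [this]

lemma dualMap_exact (hg : Function.Surjective g) (h : Function.Exact f g) :
    Function.Exact g.dualMap f.dualMap := by
  intro φ
  constructor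
  · intro hφ
    obtain ⟨ψ, hψ⟩ := exists_factor_of_exact hg h φ hφ
    exact ⟨ψ, hψ⟩
  · rintro ⟨ψ, rfl⟩
    ext x
    simp [h.apply_apply_eq_zero]

lemma dualMap_surjective_of_ext_one (hf : Function.Injective f) (hg : Function.Surjective g)
    (h : Function.Exact f g) (hZ : Subsingleton (SelfExt A Z 1)) :
    Function.Surjective f.dualMap :=
  exists_extension_of_ext_one hf hg h hZ

/-- `Ext^i(X, A) = 0` for all `i > 0`. -/
def SelfExtAcyclic (A : Type u) [CommRing A] (X : Type u) [AddCommGroup X] [Module A X] : Prop :=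
  ∀ i, Subsingleton (SelfExt A X (i + 1))

lemma SelfExtAcyclic.left (hf : Function.Injective f) (hg : Function.Surjective g)
    (h : Function.Exact f g) (hZ : SelfExtAcyclic A Z) (hY : SelfExtAcyclic A Y) :
    SelfExtAcyclic A X :=
  fun i ↦ ext_subsingleton_left _ hf hg h _ (hY i) (hZ (i + 1))

lemma SelfExtAcyclic.of_projective [Module.Projective A X] : SelfExtAcyclic A X :=
  fun i ↦ ext_subsingleton_of_projective _ i

lemma exists_free_presentation [IsNoetherianRing A] (G : Type u) [AddCommGroup G] [Module A G]
    [Module.Finite A G] :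
    ∃ (F : Type u) (_ : AddCommGroup F) (_ : Module A F) (_ : Module.Free A F)
      (_ : Module.Finite A F) (K : Type u) (_ : AddCommGroup K) (_ : Module A K)
      (_ : Module.Finite A K) (ι : K →ₗ[A] F) (π : F →ₗ[A] G),
      Function.Injective ι ∧ Function.Surjective π ∧ Function.Exact ι π := by
  obtain ⟨P, _, _, _, _, π, hπ⟩ := Module.exists_finite_presentation A G
  exact ⟨P, inferInstance, inferInstance, inferInstance, inferInstance, LinearMap.ker π,
    inferInstance, inferInstance, inferInstance, (LinearMap.ker π).subtype, π,
    Submodule.injective_subtype _, hπ, LinearMap.exact_subtype_ker_map π⟩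

/-- Dualizing 0 → K → F → X → 0 gives a short exact sequence 0 → X* → F* → K* → 0 with K again
acyclic, so degree i + 1 for X* is controlled by degree i + 2 for K*. After `n` such shifts the
degree exceeds r. -/
lemma SelfExtAcyclic.dual_aux [IsNoetherianRing A] {r : ℕ} (hr : SelfExtVanishesAbove A r) (n : ℕ)
    (X : Type u) [AddCommGroup X] [Module A X] [Module.Finite A X] (hX : SelfExtAcyclic A X)
    (i : ℕ) (hi : r < i + 1 + n) : Subsingleton (SelfExt A (Module.Dual A X) (i + 1)) := by
  induction n generalizing X i with
  | zero => exact hr _ _ (by omega)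
  | succ n ih =>
    obtain ⟨F, _, _, _, _, K, _, _, _, ι, π, hι, hπ, hex⟩ := exists_free_presentation (A := A) X
    refine ext_subsingleton_left _ (LinearMap.dualMap_injective_of_surjective hπ)
      (dualMap_surjective_of_ext_one hι hπ hex (hX 0)) (dualMap_exact hπ hex) (i + 1)
      (ext_subsingleton_of_projective _ _) ?_
    exact ih K (hX.left hι hπ hex .of_projective) (i + 1) (by omega)

lemma SelfExtAcyclic.dual [IsNoetherianRing A] {r : ℕ} (hr : SelfExtVanishesAbove A r)
    [Module.Finite A X] (hX : SelfExtAcyclic A X) : SelfExtAcyclic A (Module.Dual A X) :=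
  fun i ↦ hX.dual_aux hr r X i (by omega)

/-- A functional on X* extends to F* because Ext^1(K*, A) = 0, and functionals on F* are
evaluations. -/
lemma SelfExtAcyclic.eval_surjective [IsNoetherianRing A] {r : ℕ} (hr : SelfExtVanishesAbove A r)
    [Module.Finite A X] (hX : SelfExtAcyclic A X) :
    Function.Surjective (Module.Dual.eval A X) := by
  obtain ⟨F, _, _, _, _, K, _, _, _, ι, π, hι, hπ, hex⟩ := exists_free_presentation (A := A) X
  intro φ
  obtain ⟨ψ, hψ⟩ := exists_extension_of_ext_one (LinearMap.dualMap_injective_of_surjective hπ)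
    (dualMap_surjective_of_ext_one hι hπ hex (hX 0)) (dualMap_exact hπ hex)
    ((hX.left hι hπ hex .of_projective).dual hr 0) φ
  obtain ⟨p, rfl⟩ := (Module.bijective_dual_eval A F).2 ψ
  refine ⟨π p, ?_⟩
  rw [← hψ]
  rfl

/-- If evaluation at `π p` is zero, evaluation at `p` vanishes on X* and factors through K*.
Surjectivity for the syzygy K makes it evaluation at some `k`, so `p = ι k` and `π p = 0`. -/
lemma SelfExtAcyclic.eval_bijective [IsNoetherianRing A] {r : ℕ} (hr : SelfExtVanishesAbove A r)
    [Module.Finite A X] (hX : SelfExtAcyclic A X) :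
    Function.Bijective (Module.Dual.eval A X) := by
  refine ⟨?_, hX.eval_surjective hr⟩
  obtain ⟨F, _, _, _, _, K, _, _, _, ι, π, hι, hπ, hex⟩ := exists_free_presentation (A := A) X
  rw [injective_iff_map_eq_zero]
  intro x hx
  obtain ⟨p, rfl⟩ := hπ x
  obtain ⟨χ, hχ⟩ := exists_factor_of_exact (dualMap_surjective_of_ext_one hι hπ hex (hX 0))
    (dualMap_exact hπ hex) (Module.Dual.eval A F p) hx
  obtain ⟨k, rfl⟩ := (hX.left hι hπ hex .of_projective).eval_surjective hr χ
  have : ι k = p := by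
    apply (Module.bijective_dual_eval A F).1
    rw [← hχ]
    rfl
  rw [← this, hex.apply_apply_eq_zero]

end Duality

/-! ### Vanishing of Ext for finite free multiples in either variable. -/

section Additivity

open TensorProduct

variable {A : Type u} [CommRing A] {X Y G : Type u} [AddCommGroup X] [Module A X]
  [AddCommGroup Y] [Module A Y] [AddCommGroup G] [Module A G]

lemma extPrecomp_sum {ι : Type*} [Fintype ι] (f : ι → (X →ₗ[A] Y)) (L : ModuleCat.{u} A) (k : ℕ)
    (x : Ext (ModuleCat.of A Y) L k) :
    extPrecomp (∑ i, f i) L k x = ∑ i, extPrecomp (f i) L k x := by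
  have : ModuleCat.ofHom (∑ i, f i) = ∑ i, ModuleCat.ofHom (f i) := by
    ext x
    simp [ModuleCat.hom_sum]
  rw [extPrecomp_apply, this, Ext.mk₀_sum, Ext.sum_comp]
  rfl

lemma ext_subsingleton_of_sum_comp_eq_id {ι : Type*} [Fintype ι] (f : ι → (G →ₗ[A] X))
    (g : ι → (X →ₗ[A] G)) (h : ∑ i, f i ∘ₗ g i = LinearMap.id) (L : ModuleCat.{u} A) (k : ℕ)
    (hG : Subsingleton (Ext (ModuleCat.of A G) L k)) :
    Subsingleton (Ext (ModuleCat.of A X) L k) := by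
  refine subsingleton_of_forall_eq 0 fun x ↦ ?_
  have hx : extPrecomp (∑ i, f i ∘ₗ g i) L k x = x := by rw [h, extPrecomp_id]; rfl
  rw [← hx, extPrecomp_sum]
  refine Finset.sum_eq_zero fun i _ ↦ ?_
  rw [extPrecomp_comp, LinearMap.comp_apply, Subsingleton.elim (extPrecomp (f i) L k x) 0, map_zero]

lemma ext_tensorProduct_subsingleton (Q : Type u) [AddCommGroup Q] [Module A Q] [Module.Free A Q]
    [Module.Finite A Q] (L : ModuleCat.{u} A) (k : ℕ)
    (hG : Subsingleton (Ext (ModuleCat.of A G) L k)) :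
    Subsingleton (Ext (ModuleCat.of A (Q ⊗[A] G)) L k) := by
  let b := Module.Free.chooseBasis A Q
  refine ext_subsingleton_of_sum_comp_eq_id (fun i ↦ TensorProduct.mk A Q G (b i))
    (fun i ↦ (TensorProduct.lid A G).toLinearMap ∘ₗ LinearMap.rTensor G (b.coord i)) ?_ L k hG
  ext q g
  simp only [TensorProduct.AlgebraTensorModule.curry_apply, TensorProduct.curry_apply,
    LinearMap.restrictScalars_apply, LinearMap.sum_apply, LinearMap.comp_apply,
    LinearMap.rTensor_tmul, LinearEquiv.coe_coe, TensorProduct.lid_tmul, TensorProduct.mk_apply,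
    LinearMap.id_apply, TensorProduct.tmul_smul]
  conv_rhs => rw [← b.sum_repr q, TensorProduct.sum_tmul]
  rfl

lemma ext_free_right_subsingleton (P : Type u) [AddCommGroup P] [Module A P] [Module.Free A P]
    [Module.Finite A P] (X : ModuleCat.{u} A) (k : ℕ)
    (hX : Subsingleton (Ext X (ModuleCat.of A A) k)) :
    Subsingleton (Ext X (ModuleCat.of A P) k) := by
  let b := Module.Free.chooseBasis A P
  refine subsingleton_of_forall_eq 0 fun x ↦ ?_
  have h : 𝟙 (ModuleCat.of A P) = ∑ i, ModuleCat.ofHom (b.coord i) ≫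
      ModuleCat.ofHom (LinearMap.toSpanSingleton A P (b i)) := by
    ext p
    simp [ModuleCat.hom_sum, b.sum_repr]
  rw [← Ext.comp_mk₀_id x, h, Ext.mk₀_sum, Ext.comp_sum]
  refine Finset.sum_eq_zero fun i _ ↦ ?_
  rw [← Ext.mk₀_comp_mk₀, ← Ext.comp_assoc_of_third_deg_zero,
    Subsingleton.elim (x.comp (Ext.mk₀ (ModuleCat.ofHom (b.coord i))) (add_zero k)) 0,
    Ext.zero_comp]

end Additivity

/-! ### Degree zero: Hom and the tensor-hom adjunction. -/

section ExtZero

open TensorProduct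

variable {A : Type u} [CommRing A] {X Y G : Type u} [AddCommGroup X] [Module A X]
  [AddCommGroup Y] [Module A Y] [AddCommGroup G] [Module A G]

/-- `Ext^0` is `Hom`. -/
noncomputable def extZeroEquiv (X Y : Type u) [AddCommGroup X] [Module A X] [AddCommGroup Y]
    [Module A Y] : Ext (ModuleCat.of A X) (ModuleCat.of A Y) 0 ≃ₗ[A] (X →ₗ[A] Y) :=
  Ext.linearEquiv₀.trans ModuleCat.homLinearEquiv

lemma extZeroEquiv_mk₀ (f : X →ₗ[A] Y) : extZeroEquiv X Y (Ext.mk₀ (ModuleCat.ofHom f)) = f := by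
  have : (Ext.linearEquiv₀ (R := A)).symm (ModuleCat.ofHom f) = Ext.mk₀ (ModuleCat.ofHom f) := rfl
  rw [extZeroEquiv, LinearEquiv.trans_apply, ← this, LinearEquiv.apply_symm_apply]
  rfl

lemma extZeroEquiv_extPrecomp {L : Type u} [AddCommGroup L] [Module A L] (f : X →ₗ[A] Y)
    (x : Ext (ModuleCat.of A Y) (ModuleCat.of A L) 0) :
    extZeroEquiv X L (extPrecomp f (ModuleCat.of A L) 0 x) = extZeroEquiv Y L x ∘ₗ f := by
  obtain ⟨φ, rfl⟩ := (Ext.mk₀_bijective _ _).2 x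
  have h : extPrecomp f (ModuleCat.of A L) 0 (Ext.mk₀ φ) =
      Ext.mk₀ (ModuleCat.ofHom (φ.hom ∘ₗ f)) := by
    rw [extPrecomp_apply, Ext.mk₀_comp_mk₀]; rfl
  rw [h, extZeroEquiv_mk₀]
  have := extZeroEquiv_mk₀ φ.hom
  rw [ModuleCat.ofHom_hom] at this
  rw [this]

/-- Tensor-hom adjunction in degree zero. -/
noncomputable def selfExtTensorZeroEquiv (X G : Type u) [AddCommGroup X] [Module A X]
    [AddCommGroup G] [Module A G] :
    SelfExt A (X ⊗[A] G) 0 ≃ₗ[A] Ext (ModuleCat.of A X) (ModuleCat.of A (Module.Dual A G)) 0 :=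
  (extZeroEquiv (X ⊗[A] G) A).trans <|
    (TensorProduct.lift.equiv (RingHom.id A) X G A).symm.trans
      (extZeroEquiv X (Module.Dual A G)).symm

lemma selfExtTensorZeroEquiv_extPrecomp (f : X →ₗ[A] Y) (x : SelfExt A (Y ⊗[A] G) 0) :
    selfExtTensorZeroEquiv X G (extPrecomp (LinearMap.rTensor G f) (ModuleCat.of A A) 0 x) =
      extPrecomp f _ 0 (selfExtTensorZeroEquiv Y G x) := by
  apply (extZeroEquiv X (Module.Dual A G)).injective
  rw [extZeroEquiv_extPrecomp]
  simp only [selfExtTensorZeroEquiv, LinearEquiv.trans_apply, LinearEquiv.apply_symm_apply,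
    extZeroEquiv_extPrecomp]
  ext x g
  simp

lemma nonempty_equiv_of_ker_eq {V W W' : Type*} [AddCommGroup V] [Module A V] [AddCommGroup W]
    [Module A W] [AddCommGroup W'] [Module A W'] (f : V →ₗ[A] W) (g : V →ₗ[A] W')
    (hf : Function.Surjective f) (hg : Function.Surjective g)
    (h : LinearMap.ker f = LinearMap.ker g) : Nonempty (W ≃ₗ[A] W') :=
  ⟨(f.quotKerEquivOfSurjective hf).symm.trans
    ((Submodule.quotEquivOfEq _ _ h).trans (g.quotKerEquivOfSurjective hg))⟩

end ExtZero

/-! ### Tor_1 realized as the kernel of a tensored inclusion. -/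

section Tor

open TensorProduct

variable {A : Type u} [CommRing A]

variable {K Q D G : Type u} [AddCommGroup K] [Module A K] [AddCommGroup Q] [Module A Q]
  [AddCommGroup D] [Module A D] [AddCommGroup G] [Module A G] {ι : K →ₗ[A] Q} {π : Q →ₗ[A] D}

/-- The kernel is Tor_1(D, G) for D the cokernel of ι if Q is flat. Multiplication by `a` passes
through the corresponding kernel for P, which is zero by flatness of P. -/
lemma smul_eq_zero_of_mem_ker_rTensor {a : A} (h : FactorsThroughFree a G)
    (hι : Function.Injective ι) (x : LinearMap.ker (LinearMap.rTensor G ι)) : a • x = 0 := by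
  obtain ⟨P, _, _, _, _, i, ρ, h⟩ := h
  ext
  have hx := x.2
  rw [LinearMap.mem_ker] at hx
  have h1 : LinearMap.rTensor P ι (LinearMap.lTensor K i x) = 0 := by
    rw [← LinearMap.comp_apply, LinearMap.rTensor_comp_lTensor, ← LinearMap.lTensor_comp_rTensor,
      LinearMap.comp_apply, hx, map_zero]
  have h2 : LinearMap.lTensor K i (x : K ⊗[A] G) = 0 :=
    Module.Flat.rTensor_preserves_injective_linearMap ι hι (h1.trans (map_zero _).symm)
  have h3 := congrArg (LinearMap.lTensor K ρ) h2
  rw [← LinearMap.comp_apply, ← LinearMap.lTensor_comp, h, LinearMap.lTensor_smul,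
    LinearMap.lTensor_id, map_zero] at h3
  exact h3

/-- Balancing of Tor_1, by the snake lemma: rows come from K → Q → D, columns from G' → F → G. The
connecting map is injective because Q ⊗ G' → Q ⊗ F is, and its image is the kernel of K ⊗ G → Q ⊗ G.
-/
lemma nonempty_ker_lTensor_equiv_ker_rTensor [Module.Flat A Q] {G' F : Type u} [AddCommGroup G']
    [Module A G'] [AddCommGroup F] [Module A F] [Module.Flat A F] {α : G' →ₗ[A] F}
    {β : F →ₗ[A] G} (hι : Function.Injective ι) (hπ : Function.Surjective π)
    (hex : Function.Exact ι π) (hα : Function.Injective α) (hβ : Function.Surjective β)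
    (hex' : Function.Exact α β) :
    Nonempty (LinearMap.ker (LinearMap.lTensor D α) ≃ₗ[A] LinearMap.ker (LinearMap.rTensor G ι)) := by
  have hcomm {X Y V W : Type u} [AddCommGroup X] [Module A X] [AddCommGroup Y] [Module A Y]
      [AddCommGroup V] [Module A V] [AddCommGroup W] [Module A W] (f : X →ₗ[A] Y)
      (g : V →ₗ[A] W) : (LinearMap.rTensor W f).comp (LinearMap.lTensor X g) =
        (LinearMap.lTensor Y g).comp (LinearMap.rTensor V f) := by
    rw [LinearMap.rTensor_comp_lTensor, LinearMap.lTensor_comp_rTensor]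
  have hinj : Function.Injective (LinearMap.lTensor Q α) :=
    Module.Flat.lTensor_preserves_injective_linearMap α hα
  have hinj' : Function.Injective (LinearMap.rTensor F ι) :=
    Module.Flat.rTensor_preserves_injective_linearMap ι hι
  have e1 := rTensor_exact G' hex hπ
  have e2 := rTensor_exact F hex hπ
  let δ := SnakeLemma.δ' _ _ _ _ _ e1 _ _ e2 (hcomm ι α) (hcomm π α) _
    (LinearMap.exact_subtype_ker_map (LinearMap.lTensor D α)) _ (lTensor_exact K hex' hβ)
    (LinearMap.rTensor_surjective G' hπ) hinj'
  have ex1 : Function.Exact (0 : PUnit.{u + 1} →ₗ[A] _) δ :=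
    SnakeLemma.exact_δ'_right _ _ _ _ _ e1 _ _ e2 (hcomm ι α) (hcomm π α) 0
      ((LinearMap.exact_zero_iff_injective _ _).2 hinj) _
      (LinearMap.exact_subtype_ker_map (LinearMap.lTensor D α)) _ (lTensor_exact K hex' hβ)
      (LinearMap.rTensor_surjective G' hπ) hinj' 0 (by simp) (Submodule.injective_subtype _)
  have ex2 : Function.Exact δ (LinearMap.rTensor G ι) :=
    SnakeLemma.exact_δ'_left _ _ _ _ _ e1 _ _ e2 (hcomm ι α) (hcomm π α) _
      (LinearMap.exact_subtype_ker_map (LinearMap.lTensor D α)) _ (lTensor_exact K hex' hβ) _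
      (lTensor_exact Q hex' hβ) (LinearMap.rTensor_surjective G' hπ) hinj'
      _ (hcomm ι β) (LinearMap.lTensor_surjective K hβ)
  have hδ : Function.Injective δ := (LinearMap.exact_zero_iff_injective _ _).1 ex1
  exact ⟨(LinearEquiv.ofInjective δ hδ).trans (LinearEquiv.ofEq _ _ ex2.linearMap_ker_eq.symm)⟩

/-- The factorization `K ⊗ G → im → Q ⊗ G → D ⊗ G` of the four-term exact sequence. -/
lemma exists_tensor_image [IsNoetherianRing A] {ι : K →ₗ[A] Q} {π : Q →ₗ[A] D}
    (hπ : Function.Surjective π)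
    (hex : Function.Exact ι π) :
    ∃ (B : Type u) (_ : AddCommGroup B) (_ : Module A B) (p : K ⊗[A] G →ₗ[A] B)
      (q : B →ₗ[A] Q ⊗[A] G), q ∘ₗ p = LinearMap.rTensor G ι ∧ Function.Surjective p ∧
      Function.Injective q ∧ Function.Exact (LinearMap.ker (LinearMap.rTensor G ι)).subtype p ∧
      Function.Exact q (LinearMap.rTensor G π) ∧ (Module.Finite A (Q ⊗[A] G) → Module.Finite A B) := by
  refine ⟨LinearMap.range (LinearMap.rTensor G ι), inferInstance, inferInstance,
    LinearMap.rangeRestrict _, Submodule.subtype _, rfl, LinearMap.surjective_rangeRestrict _,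
    Submodule.injective_subtype _, ?_, ?_, fun _ ↦ inferInstance⟩
  · rw [LinearMap.exact_iff, LinearMap.ker_rangeRestrict, Submodule.range_subtype]
  · rw [LinearMap.exact_iff, Submodule.range_subtype]
    exact (rTensor_exact G hex hπ).linearMap_ker_eq

/-- `Ext^1(D, Hom(G, A))` is the cokernel of `Hom(Q ⊗ G, A) → Hom(K ⊗ G, A)`. -/
lemma exists_ext_one_dual_cokernel [Module.Projective A Q] {ι : K →ₗ[A] Q} {π : Q →ₗ[A] D}
    (hι : Function.Injective ι) (hπ : Function.Surjective π) (hex : Function.Exact ι π) :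
    ∃ Φ : SelfExt A (K ⊗[A] G) 0 →ₗ[A]
        Ext (ModuleCat.of A D) (ModuleCat.of A (Module.Dual A G)) 1,
      Function.Surjective Φ ∧
        LinearMap.ker Φ = LinearMap.range (extPrecomp (LinearMap.rTensor G ι) (ModuleCat.of A A) 0)
        := by
  obtain ⟨δ, hδ, hδ'⟩ := exists_ext_connecting (ModuleCat.of A (Module.Dual A G)) hι hπ hex 0
  have hQ := ext_subsingleton_of_projective (X := Q) (ModuleCat.of A (Module.Dual A G)) 0
  refine ⟨δ ∘ₗ (selfExtTensorZeroEquiv K G).toLinearMap, ?_, ?_⟩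
  · exact Function.Surjective.comp (g := δ) (fun x ↦ (hδ' x).1 (hQ.elim _ _))
      (LinearEquiv.surjective _)
  · ext x
    rw [LinearMap.mem_ker, LinearMap.comp_apply, hδ _]
    constructor
    · rintro ⟨y, hy⟩
      refine ⟨(selfExtTensorZeroEquiv Q G).symm y, ?_⟩
      apply (selfExtTensorZeroEquiv K G).injective
      rw [selfExtTensorZeroEquiv_extPrecomp, LinearEquiv.apply_symm_apply, hy]
      rfl
    · rintro ⟨y, rfl⟩
      exact ⟨selfExtTensorZeroEquiv Q G y, (selfExtTensorZeroEquiv_extPrecomp ι y).symm⟩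

end Tor

/-! ### The length of Ext(D, G*) in terms of Tor_1. -/

section Formula

open TensorProduct

variable {A : Type u} [CommRing A] [IsLocalRing A]

/-- Finitely generated modules `G` with `Ext^i(G, A) = 0` for `i > 0` whose stable endomorphism
ring is annihilated by a power of the maximal ideal. -/
structure IsStablyFiniteLength (A : Type u) [CommRing A] [IsLocalRing A] (G : Type u)
    [AddCommGroup G] [Module A G] : Prop where
  finite : Module.Finite A G
  acyclic : SelfExtAcyclic A G
  factors : ∃ k : ℕ, ∀ a ∈ IsLocalRing.maximalIdeal A ^ k, FactorsThroughFree a G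

lemma IsStablyFiniteLength.dual [IsNoetherianRing A] {r : ℕ} (hr : SelfExtVanishesAbove A r)
    {G : Type u}
    [AddCommGroup G] [Module A G] (hG : IsStablyFiniteLength A G) :
    IsStablyFiniteLength A (Module.Dual A G) where
  finite := have := hG.finite; inferInstance
  acyclic := have := hG.finite; hG.acyclic.dual hr
  factors := by
    obtain ⟨k, hk⟩ := hG.factors
    exact ⟨k, fun a ha ↦ (hk a ha).dual⟩

variable {K Q D G : Type u} [AddCommGroup K] [Module A K] [AddCommGroup Q] [Module A Q]
  [AddCommGroup D] [Module A D] [AddCommGroup G] [Module A G]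

lemma IsStablyFiniteLength.syzygy [IsNoetherianRing A] (hG : IsStablyFiniteLength A G)
    [Module.Free A Q]
    [Module.Finite A Q] {α : K →ₗ[A] Q} {β : Q →ₗ[A] G} (hα : Function.Injective α)
    (hβ : Function.Surjective β) (hex : Function.Exact α β) : IsStablyFiniteLength A K where
  finite := Module.Finite.of_injective α hα
  acyclic := hG.acyclic.left hα hβ hex .of_projective
  factors := by
    obtain ⟨k, hk⟩ := hG.factors
    refine ⟨k, fun a ha ↦ ?_⟩
    obtain ⟨ρ, hρ⟩ := (hk a ha).exists_retraction hα hβ hex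
    exact ⟨Q, inferInstance, inferInstance, inferInstance, inferInstance, α, ρ, hρ⟩

/-- This kernel is finitely generated and killed by a power of the maximal ideal. -/
lemma IsStablyFiniteLength.isFiniteLength_ker_rTensor [IsNoetherianRing A]
    (hG : IsStablyFiniteLength A G)
    [Module.Finite A K] {ι : K →ₗ[A] Q} (hι : Function.Injective ι) :
    IsFiniteLength A (LinearMap.ker (LinearMap.rTensor G ι)) := by
  have := hG.finite
  obtain ⟨k, hk⟩ := hG.factors
  exact Module.length_ne_top_iff.1 <| length_ne_top_of_maximalIdeal_pow_le _ inferInstance k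
    fun a ha ↦ Module.mem_annihilator.2 (smul_eq_zero_of_mem_ker_rTensor (hk a ha) hι)

/-- Dimension shifting in D. Let B be the image of K ⊗ G in Q ⊗ G. The kernel of K ⊗ G → B has
finite length, so its Ext into A vanishes below degree r and K ⊗ G may be replaced by B there; then
0 → B → Q ⊗ G → D ⊗ G → 0 shifts the degree back up, as Q ⊗ G is acyclic. -/
lemma nonempty_ext_dual_equiv_selfExt_tensor [IsNoetherianRing A] {r : ℕ}
    (hr : SelfExtVanishesAbove A r)
    (hk : Nontrivial (SelfExt A (A ⧸ IsLocalRing.maximalIdeal A) r))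
    (hG : IsStablyFiniteLength A G) (i : ℕ) (hi : i + 1 ≤ r) (D : Type u) [AddCommGroup D]
    [Module A D] [Module.Finite A D] :
    Nonempty (Ext (ModuleCat.of A D) (ModuleCat.of A (Module.Dual A G)) (i + 1) ≃ₗ[A]
      SelfExt A (D ⊗[A] G) (i + 1)) := by
  induction i generalizing D with
  | zero =>
    obtain ⟨Q, _, _, _, _, K, _, _, _, ι, π, hι, hπ, hex⟩ := exists_free_presentation (A := A) D
    obtain ⟨B, _, _, p, q, hpq, hp, hq, hexp, hexq, -⟩ := exists_tensor_image (G := G) hπ hex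
    obtain ⟨Φ, hΦ, hkerΦ⟩ := exists_ext_one_dual_cokernel (G := G) hι hπ hex
    have hH := (selfExt_of_isFiniteLength hr hk _ (hG.isFiniteLength_ker_rTensor hι)).1
    have hbij := extPrecomp_bijective_right (ModuleCat.of A A) (Submodule.injective_subtype _) hp
      hexp 0 (fun k hk ↦ by omega) (hH 0 (by omega))
    let e := LinearEquiv.ofBijective _ hbij
    obtain ⟨δ, hδ, hδ'⟩ := exists_ext_connecting (ModuleCat.of A A) hq
      (LinearMap.rTensor_surjective G hπ) hexq 0
    have hQ : Subsingleton (SelfExt A (Q ⊗[A] G) 1) :=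
      ext_tensorProduct_subsingleton Q _ 1 (hG.acyclic 0)
    refine nonempty_equiv_of_ker_eq Φ (δ ∘ₗ e.symm.toLinearMap) hΦ
      (Function.Surjective.comp (g := δ) (fun x ↦ (hδ' x).1 (hQ.elim _ _))
        (LinearEquiv.surjective _)) ?_
    rw [hkerΦ]
    ext x
    rw [LinearMap.mem_ker, LinearMap.comp_apply, hδ _, ← hpq, extPrecomp_comp]
    constructor
    · rintro ⟨y, rfl⟩
      refine ⟨y, ?_⟩
      exact (e.symm_apply_apply _).symm
    · rintro ⟨y, hy⟩
      exact ⟨y, (congrArg e hy).trans (e.apply_symm_apply x)⟩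
  | succ i ih =>
    obtain ⟨Q, _, _, _, _, K, _, _, _, ι, π, hι, hπ, hex⟩ := exists_free_presentation (A := A) D
    obtain ⟨B, _, _, p, q, hpq, hp, hq, hexp, hexq, -⟩ := exists_tensor_image (G := G) hπ hex
    have hH := (selfExt_of_isFiniteLength hr hk _ (hG.isFiniteLength_ker_rTensor hι)).1
    obtain ⟨e1⟩ := nonempty_ext_equiv_connecting (ModuleCat.of A (Module.Dual A G)) hι hπ hex
      (i + 1) (ext_subsingleton_of_projective _ _) (ext_subsingleton_of_projective _ _)
    obtain ⟨e2⟩ := ih (by omega) K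
    let e3 := LinearEquiv.ofBijective _ <| extPrecomp_bijective_right (ModuleCat.of A A)
      (Submodule.injective_subtype _) hp hexp (i + 1) (fun k hk ↦ hH k (by omega))
      (hH (i + 1) (by omega))
    obtain ⟨e4⟩ := nonempty_ext_equiv_connecting (ModuleCat.of A A) hq
      (LinearMap.rTensor_surjective G hπ) hexq (i + 1)
      (ext_tensorProduct_subsingleton Q _ _ (hG.acyclic i))
      (ext_tensorProduct_subsingleton Q _ _ (hG.acyclic (i + 1)))
    exact ⟨e1.symm.trans (e2.trans (e3.symm.trans e4))⟩

/-- In degree r the kernel T of K ⊗ G → B finally contributes. For r > 0, Ext^(r+1)(D, G*) ≅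
Ext^r(K, G*) ≅ Ext^r(K ⊗ G, A), and this is Ext^r(T, A) because Ext^r(B, A) and Ext^(r+1)(B, A)
vanish. -/
lemma nonempty_ext_dual_equiv_selfExt_ker [IsNoetherianRing A] {r : ℕ}
    (hr : SelfExtVanishesAbove A r)
    (hk : Nontrivial (SelfExt A (A ⧸ IsLocalRing.maximalIdeal A) r))
    (hG : IsStablyFiniteLength A G) [Module.Finite A D] [Module.Finite A Q] [Module.Free A Q]
    {ι : K →ₗ[A] Q} {π : Q →ₗ[A] D}
    (hι : Function.Injective ι) (hπ : Function.Surjective π) (hex : Function.Exact ι π) :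
    Nonempty (Ext (ModuleCat.of A D) (ModuleCat.of A (Module.Dual A G)) (r + 1) ≃ₗ[A]
      SelfExt A (LinearMap.ker (LinearMap.rTensor G ι)) r) := by
  have := hG.finite
  have : Module.Finite A K := Module.Finite.of_injective ι hι
  obtain ⟨B, _, _, p, q, hpq, hp, hq, hexp, hexq, hB⟩ := exists_tensor_image (G := G) hπ hex
  have hB' : Module.Finite A B := hB inferInstance
  have hB1 : Subsingleton (SelfExt A B (r + 1)) := hr B _ (Nat.lt_succ_self r)
  have hD1 : Subsingleton (SelfExt A (D ⊗[A] G) (r + 1)) := hr _ _ (Nat.lt_succ_self r)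
  cases r with
  | zero =>
    -- For r = 0, Hom(B, A) need not vanish. Both sides are instead quotients of Hom(K ⊗ G, A) by
    -- the same submodule, since Hom(Q ⊗ G, A) → Hom(B, A) is onto.
    obtain ⟨Φ, hΦ, hkerΦ⟩ := exists_ext_one_dual_cokernel (G := G) hι hπ hex
    refine nonempty_equiv_of_ker_eq Φ
      (extPrecomp (LinearMap.ker (LinearMap.rTensor G ι)).subtype (ModuleCat.of A A) 0) hΦ
      (extPrecomp_surjective _ (Submodule.injective_subtype _) hp hexp 0 hB1) ?_
    rw [hkerΦ, (extPrecomp_exact _ (Submodule.injective_subtype _) hp hexp 0).linearMap_ker_eq,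
      ← hpq, extPrecomp_comp, LinearMap.range_comp_of_range_eq_top]
    exact LinearMap.range_eq_top.2 (extPrecomp_surjective _ hq
      (LinearMap.rTensor_surjective G hπ) hexq 0 hD1)
  | succ r =>
    obtain ⟨e1⟩ := nonempty_ext_equiv_connecting (ModuleCat.of A (Module.Dual A G)) hι hπ hex
      (r + 1) (ext_subsingleton_of_projective _ _) (ext_subsingleton_of_projective _ _)
    obtain ⟨e2⟩ := nonempty_ext_dual_equiv_selfExt_tensor hr hk hG r le_rfl K
    have hB0 : Subsingleton (SelfExt A B (r + 1)) :=
      ext_subsingleton_left _ hq (LinearMap.rTensor_surjective G hπ) hexq (r + 1)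
        (ext_tensorProduct_subsingleton Q _ _ (hG.acyclic r)) hD1
    let e3 := LinearEquiv.ofBijective _ <| extPrecomp_bijective_left (ModuleCat.of A A)
      (Submodule.injective_subtype _) hp hexp (r + 1) hB0 hB1
    exact ⟨e1.symm.trans (e2.trans e3)⟩

/-- The sequence 0 → G* → Q* → K* → 0 is exact and Ext^j(D, Q*) = 0 for j > r, so the connecting map
is an isomorphism. -/
lemma nonempty_ext_dual_equiv_ext_dual_syzygy {r : ℕ} (hr : SelfExtVanishesAbove A r)
    (hG : IsStablyFiniteLength A G) [Module.Free A Q] [Module.Finite A Q] {α : K →ₗ[A] Q}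
    {β : Q →ₗ[A] G} (hα : Function.Injective α) (hβ : Function.Surjective β)
    (hex : Function.Exact α β) [Module.Finite A D] (j : ℕ) (hj : r < j) :
    Nonempty (Ext (ModuleCat.of A D) (ModuleCat.of A (Module.Dual A K)) j ≃ₗ[A]
      Ext (ModuleCat.of A D) (ModuleCat.of A (Module.Dual A G)) (j + 1)) := by
  have S := shortExact_of_exact (LinearMap.dualMap_injective_of_surjective hβ)
    (dualMap_surjective_of_ext_one hα hβ hex (hG.acyclic 0)) (dualMap_exact hβ hex)
  have h1 : Subsingleton (Ext (ModuleCat.of A D) (ModuleCat.of A (Module.Dual A Q)) j) :=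
    ext_free_right_subsingleton _ _ _ (hr D j hj)
  have h2 : Subsingleton (Ext (ModuleCat.of A D) (ModuleCat.of A (Module.Dual A Q)) (j + 1)) :=
    ext_free_right_subsingleton _ _ _ (hr D (j + 1) (by omega))
  refine ⟨LinearEquiv.ofBijective (S.extClass.postcompOfLinear A (ModuleCat.of A D) rfl) ⟨?_, ?_⟩⟩
  · rw [injective_iff_map_eq_zero]
    intro x hx
    obtain ⟨y, rfl⟩ := Ext.covariant_sequence_exact₃ _ S x rfl hx
    rw [h1.elim y 0]
    exact Ext.zero_comp _ _ _ _ _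
  · intro x
    exact Ext.covariant_sequence_exact₁ _ S x (h2.elim _ _) rfl

/-- The map K → F, a presentation of an iterated syzygy of G, is chosen before D; this uniformity
permits D to run through the quotients N/I^n N. -/
lemma exists_length_ext_dual_eq [IsNoetherianRing A] {r : ℕ} (hr : SelfExtVanishesAbove A r)
    (hk : Nontrivial (SelfExt A (A ⧸ IsLocalRing.maximalIdeal A) r)) (i : ℕ)
    (G : Type u) [AddCommGroup G] [Module A G] (hG : IsStablyFiniteLength A G) :
    ∃ (F : Type u) (_ : AddCommGroup F) (_ : Module A F) (K : Type u) (_ : AddCommGroup K)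
      (_ : Module A K) (_ : Module.Finite A F) (_ : Module.Finite A K) (α : K →ₗ[A] F),
      ∀ (D : Type u) [AddCommGroup D] [Module A D] [Module.Finite A D],
        IsFiniteLength A (LinearMap.ker (LinearMap.lTensor D α)) ∧
        Module.length A (Ext (ModuleCat.of A D) (ModuleCat.of A (Module.Dual A G)) (r + 1 + i)) =
          Module.length A (LinearMap.ker (LinearMap.lTensor D α)) *
            Module.length A (SelfExt A (A ⧸ IsLocalRing.maximalIdeal A) r) := by
  induction i generalizing G with
  | zero =>
    have := hG.finite
    obtain ⟨F, _, _, _, _, K, _, _, _, α, β, hα, hβ, hex⟩ := exists_free_presentation (A := A) G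
    refine ⟨F, inferInstance, inferInstance, K, inferInstance, inferInstance, inferInstance,
      inferInstance, α, fun D _ _ _ ↦ ?_⟩
    obtain ⟨Q, _, _, _, _, K', _, _, _, ι, π, hι, hπ, hex''⟩ := exists_free_presentation (A := A) D
    obtain ⟨e1⟩ := nonempty_ext_dual_equiv_selfExt_ker hr hk hG hι hπ hex''
    obtain ⟨e2⟩ := nonempty_ker_lTensor_equiv_ker_rTensor hι hπ hex'' hα hβ hex
    have hfin := hG.isFiniteLength_ker_rTensor hι
    refine ⟨hfin.of_injective e2.injective, ?_⟩
    rw [add_zero, e1.length_eq, (selfExt_of_isFiniteLength hr hk _ hfin).2, e2.length_eq]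
  | succ i ih =>
    have := hG.finite
    obtain ⟨F, _, _, _, _, K, _, _, _, α, β, hα, hβ, hex⟩ := exists_free_presentation (A := A) G
    have hK := hG.syzygy hα hβ hex
    obtain ⟨F₀, i1, i2, K₀, i3, i4, i5, i6, α₀, h⟩ := ih K hK
    refine ⟨F₀, i1, i2, K₀, i3, i4, i5, i6, α₀, fun D _ _ _ ↦ ⟨(h D).1, ?_⟩⟩
    obtain ⟨e⟩ := nonempty_ext_dual_equiv_ext_dual_syzygy (D := D) hr hG hα hβ hex (r + 1 + i)
      (by omega)
    rw [← (h D).2, e.length_eq]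
    rfl

end Formula

/-! ### Polynomial summation. -/

section NumericalPolynomials

open Polynomial

lemma Polynomial.exists_forward_difference_eq (Q : ℚ[X]) :
    ∃ R : ℚ[X], ∀ n : ℕ, R.eval ((n : ℚ) + 1) - R.eval (n : ℚ) = Q.eval (n : ℚ) := by
  induction Q using Polynomial.induction_on' with
  | add P Q hP hQ =>
    obtain ⟨R, hR⟩ := hP
    obtain ⟨S, hS⟩ := hQ
    refine ⟨R + S, fun n ↦ ?_⟩
    rw [eval_add, eval_add, eval_add, ← hR, ← hS]
    ring
  | monomial k c =>
    -- The Bernoulli polynomial satisfies B_(k+1)(x + 1) - B_(k+1)(x) = (k + 1) x^k.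
    refine ⟨C (c / (k + 1)) * Polynomial.bernoulli (k + 1), fun n ↦ ?_⟩
    have h := congrArg (Polynomial.eval (n : ℚ)) (Polynomial.bernoulli_comp_one_add_X (k + 1))
    simp only [eval_comp, eval_add, eval_one, eval_X, eval_smul, eval_pow,
      Nat.add_sub_cancel] at h
    simp only [eval_mul, eval_C]
    rw [add_comm (n : ℚ) 1, h, eval_monomial]
    have : (k : ℚ) + 1 ≠ 0 := by positivity
    simp only [nsmul_eq_mul]
    push_cast
    field_simp
    ring

lemma exists_polynomial_of_forward_difference {h : ℕ → ℚ} {Q : ℚ[X]}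
    (hQ : ∀ᶠ n : ℕ in Filter.atTop, h (n + 1) - h n = Q.eval (n : ℚ)) :
    ∃ P : ℚ[X], ∀ᶠ n : ℕ in Filter.atTop, h n = P.eval (n : ℚ) := by
  obtain ⟨R, hR⟩ := Q.exists_forward_difference_eq
  obtain ⟨n₀, hn₀⟩ := Filter.eventually_atTop.1 hQ
  refine ⟨R + C (h n₀ - R.eval (n₀ : ℚ)), Filter.eventually_atTop.2 ⟨n₀, fun n hn ↦ ?_⟩⟩
  induction n, hn using Nat.le_induction with
  | base => simp
  | succ n hn ih =>
    have h1 := hn₀ n hn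
    have h2 := hR n
    simp only [eval_add, eval_C] at ih ⊢
    push_cast
    linarith

end NumericalPolynomials

/-! ### Hilbert polynomials for sequences of modules with commuting degree one operators. -/

section GradedSequences

universe v

variable {A : Type*} [CommRing A]

/-- Families of submodules of a sequence of modules that are closed under the given operators of
degree one, that is, graded submodules of `⨁ V n`. -/
def GradedSub {ι : Type*} {V : ℕ → Type v} [∀ n, AddCommGroup (V n)] [∀ n, Module A (V n)]
    (f : ι → ∀ n, V n →ₗ[A] V (n + 1)) : Type v :=
  {W : ∀ n, Submodule A (V n) // ∀ i n, ∀ x ∈ W n, f i n x ∈ W (n + 1)}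

instance {ι : Type*} {V : ℕ → Type v} [∀ n, AddCommGroup (V n)] [∀ n, Module A (V n)]
    (f : ι → ∀ n, V n →ₗ[A] V (n + 1)) : PartialOrder (GradedSub f) :=
  inferInstanceAs (PartialOrder (Subtype _))

/-- Without operators every family of submodules is allowed, so the truncations of V below degree k
form an ascending chain; it stabilizes only if V is eventually zero. -/
lemma GradedSub.eventually_subsingleton {ι : Type*} [IsEmpty ι] {V : ℕ → Type v}
    [∀ n, AddCommGroup (V n)] [∀ n, Module A (V n)] (f : ι → ∀ n, V n →ₗ[A] V (n + 1))
    [WellFoundedGT (GradedSub f)] : ∃ n₀, ∀ n ≥ n₀, Subsingleton (V n) := by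
  classical
  let s : ℕ →o GradedSub f :=
    { toFun k := ⟨fun n ↦ if n < k then ⊤ else ⊥, fun i ↦ isEmptyElim i⟩
      monotone' k l hkl := by
        intro n
        dsimp only
        split_ifs with h1 h2
        · exact le_rfl
        · omega
        · exact bot_le
        · exact le_rfl }
  obtain ⟨n₀, h⟩ := WellFoundedGT.monotone_chain_condition s
  refine ⟨n₀, fun n hn ↦ ?_⟩
  have h1 : (if n < n₀ then (⊤ : Submodule A (V n)) else ⊥) = if n < n + 1 then ⊤ else ⊥ :=
    congrArg (fun W : GradedSub f ↦ W.1 n) (h (n + 1) (by omega))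
  rw [if_neg (by omega), if_pos (by omega)] at h1
  exact (Submodule.subsingleton_iff A).1 (subsingleton_of_bot_eq_top h1)

variable {m : ℕ} {V : ℕ → Type v} [∀ n, AddCommGroup (V n)] [∀ n, Module A (V n)]
  (f : Fin (m + 1) → ∀ n, V n →ₗ[A] V (n + 1))
  (hf : ∀ i j n x, f i (n + 1) (f j n x) = f j (n + 1) (f i n x))

-- The last operator is zero on its own kernel, so families stable under the remaining operators
-- embed into `GradedSub f` and the chain condition is inherited.
include hf in
lemma exists_kernel_operators [WellFoundedGT (GradedSub f)] :
    ∃ g : Fin m → ∀ n, LinearMap.ker (f (Fin.last m) n) →ₗ[A]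
        LinearMap.ker (f (Fin.last m) (n + 1)),
      (∀ i j n x, g i (n + 1) (g j n x) = g j (n + 1) (g i n x)) ∧
      WellFoundedGT (GradedSub g) := by
  let g : Fin m → ∀ n, LinearMap.ker (f (Fin.last m) n) →ₗ[A]
      LinearMap.ker (f (Fin.last m) (n + 1)) := fun i n ↦
    (f i.castSucc n).restrict (p := LinearMap.ker (f (Fin.last m) n)) fun x hx ↦ by
      rw [LinearMap.mem_ker] at hx ⊢
      rw [hf, hx, map_zero]
  refine ⟨g, fun i j n x ↦ Subtype.ext (hf _ _ _ _), ?_⟩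
  let Φ : GradedSub g → GradedSub f := fun W ↦
    ⟨fun n ↦ (W.1 n).map (LinearMap.ker (f (Fin.last m) n)).subtype, by
      rintro i n _ ⟨x, hx, rfl⟩
      induction i using Fin.lastCases with
      | last =>
        rw [Submodule.subtype_apply, x.2]
        exact zero_mem _
      | cast i => exact ⟨g i n x, W.2 i n x hx, rfl⟩⟩
  have hΦ : ∀ W W', Φ W ≤ Φ W' ↔ W ≤ W' := fun W W' ↦
    forall_congr' fun n ↦ Submodule.map_le_map_iff_of_injective (Submodule.injective_subtype _) _ _
  exact (OrderEmbedding.ofMapLEIff Φ hΦ).strictMono.wellFoundedGT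

include hf in
lemma exists_cokernel_operators [WellFoundedGT (GradedSub f)] :
    ∃ g : Fin m → ∀ n, (V (n + 1) ⧸ LinearMap.range (f (Fin.last m) n)) →ₗ[A]
        (V (n + 2) ⧸ LinearMap.range (f (Fin.last m) (n + 1))),
      (∀ i j n x, g i (n + 1) (g j n x) = g j (n + 1) (g i n x)) ∧
      WellFoundedGT (GradedSub (V := fun n ↦ V (n + 1) ⧸ LinearMap.range (f (Fin.last m) n)) g) := by
  let g : Fin m → ∀ n, (V (n + 1) ⧸ LinearMap.range (f (Fin.last m) n)) →ₗ[A]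
      (V (n + 2) ⧸ LinearMap.range (f (Fin.last m) (n + 1))) := fun i n ↦
    Submodule.mapQ _ _ (f i.castSucc (n + 1)) (by
      rintro _ ⟨x, rfl⟩
      exact ⟨f i.castSucc n x, hf _ _ _ _⟩)
  refine ⟨g, fun i j n x ↦ ?_, ?_⟩
  · obtain ⟨x, rfl⟩ := Submodule.mkQ_surjective _ x
    simp [g, hf i.castSucc j.castSucc]
  -- The cokernel indexed by n lives in degree n + 1, so preimages are placed one degree higher and
  -- degree 0 receives `⊥`.
  let Φ : GradedSub (V := fun n ↦ V (n + 1) ⧸ LinearMap.range (f (Fin.last m) n)) g → GradedSub f :=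
    fun W ↦ ⟨fun n ↦ Nat.casesOn n ⊥ fun n ↦ (W.1 n).comap (Submodule.mkQ _), by
      intro i n x hx
      cases n with
      | zero =>
        obtain rfl : x = 0 := hx
        rw [map_zero]
        exact zero_mem _
      | succ n =>
        induction i using Fin.lastCases with
        | last =>
          change Submodule.mkQ _ _ ∈ W.1 (n + 1)
          have : Submodule.mkQ (LinearMap.range (f (Fin.last m) (n + 1)))
              (f (Fin.last m) (n + 1) x) = 0 := by simp
          rw [this]
          exact zero_mem _
        | cast i => exact W.2 i n _ hx⟩
  have hΦ : ∀ W W', Φ W ≤ Φ W' ↔ W ≤ W' := by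
    intro W W'
    constructor
    · intro h n x hx
      obtain ⟨x, rfl⟩ := Submodule.mkQ_surjective _ x
      exact h (n + 1) hx
    · intro h n
      cases n with
      | zero => exact le_rfl
      | succ n => exact Submodule.comap_mono (h n)
  exact (OrderEmbedding.ofMapLEIff Φ hΦ).strictMono.wellFoundedGT

/-- The Hilbert-Serre induction on the number of operators: ℓ(V (n+1)) - ℓ(V n) is the length of the
cokernel minus that of the kernel of the last operator, both polynomial by induction. The chain
condition on graded families plays the role of Noetherianity over a polynomial ring. -/
theorem exists_hilbert_polynomial {m : ℕ} {V : ℕ → Type v} [∀ n, AddCommGroup (V n)]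
    [∀ n, Module A (V n)] (f : Fin m → ∀ n, V n →ₗ[A] V (n + 1))
    (hf : ∀ i j n x, f i (n + 1) (f j n x) = f j (n + 1) (f i n x))
    (hV : ∀ n, Module.length A (V n) ≠ ⊤) (hacc : WellFoundedGT (GradedSub f)) :
    ∃ P : Polynomial ℚ, ∀ᶠ n : ℕ in Filter.atTop,
      ((Module.length A (V n)).toNat : ℚ) = P.eval (n : ℚ) := by
  induction m generalizing V with
  | zero =>
    obtain ⟨n₀, h⟩ := GradedSub.eventually_subsingleton f
    refine ⟨0, Filter.eventually_atTop.2 ⟨n₀, fun n hn ↦ ?_⟩⟩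
    have := h n hn
    simp [Module.length_eq_zero]
  | succ m ih =>
    obtain ⟨g, hg, hgacc⟩ := exists_kernel_operators f hf
    obtain ⟨g', hg', hgacc'⟩ := exists_cokernel_operators f hf
    have hK (n : ℕ) : Module.length A (LinearMap.ker (f (Fin.last m) n)) ≠ ⊤ :=
      ne_top_of_le_ne_top (hV n) (Module.length_le_of_injective _ (Submodule.injective_subtype _))
    have hC (n : ℕ) : Module.length A (V (n + 1) ⧸ LinearMap.range (f (Fin.last m) n)) ≠ ⊤ :=
      ne_top_of_le_ne_top (hV (n + 1))
        (Module.length_le_of_surjective _ (Submodule.mkQ_surjective _))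
    obtain ⟨P, hP⟩ := ih g hg hK hgacc
    obtain ⟨P', hP'⟩ := ih g' hg' hC hgacc'
    refine exists_polynomial_of_forward_difference (Q := P' - P) ?_
    filter_upwards [hP, hP'] with n h1 h2
    have e1 := Module.length_eq_add_of_exact _ _
      (Submodule.injective_subtype (LinearMap.ker (f (Fin.last m) n)))
      (LinearMap.surjective_rangeRestrict (f (Fin.last m) n))
      (by rw [LinearMap.exact_iff, LinearMap.ker_rangeRestrict, Submodule.range_subtype])
    have e2 := Module.length_eq_add_of_exact _ _
      (Submodule.injective_subtype (LinearMap.range (f (Fin.last m) n)))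
      (Submodule.mkQ_surjective _) (LinearMap.exact_subtype_mkQ _)
    have hR : Module.length A (LinearMap.range (f (Fin.last m) n)) ≠ ⊤ :=
      ne_top_of_le_ne_top (hV (n + 1))
        (Module.length_le_of_injective _ (Submodule.injective_subtype _))
    rw [e1, e2, ENat.toNat_add (hK n) hR, ENat.toNat_add hR (hC n), Polynomial.eval_sub, ← h1, ← h2]
    push_cast
    ring

end GradedSequences

/-! ### Polynomiality for subquotients of the Rees module. -/

section Subquotients

universe v w

variable {A : Type*} [CommRing A] {E : Type v} [AddCommGroup E] [Module A E]

/-- Preimages of a stable family form a graded submodule of ⨁ I^n E over the Rees algebra. That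
module is Noetherian because the I-adic filtration is stable, and the family is recovered from its
preimages. -/
lemma wellFoundedGT_gradedSub_of_surjective [IsNoetherianRing A] [Module.Finite A E] {m : ℕ}
    {I : Ideal A} {a : Fin m → A} (ha : I = Ideal.span (Set.range a)) {U : ℕ → Submodule A E}
    (hU : ∀ n, U n ≤ I ^ n • ⊤) (hUI : ∀ n, I • U n ≤ U (n + 1)) {V : ℕ → Type w}
    [∀ n, AddCommGroup (V n)] [∀ n, Module A (V n)] (q : ∀ n, U n →ₗ[A] V n)
    (hq : ∀ n, Function.Surjective (q n)) (f : Fin m → ∀ n, V n →ₗ[A] V (n + 1))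
    (hf : ∀ i n (x : U n) (y : U (n + 1)), (y : E) = a i • (x : E) → f i n (q n x) = q (n + 1) y) :
    WellFoundedGT (GradedSub f) := by
  let lift (W : GradedSub f) (n : ℕ) : Submodule A E := ((W.1 n).comap (q n)).map (U n).subtype
  have hlift (W : GradedSub f) (n : ℕ) : I • lift W n ≤ lift W (n + 1) := by
    refine Submodule.smul_le.2 fun r hr x hx ↦ ?_
    rw [ha] at hr
    induction hr using Submodule.span_induction with
    | mem r hr =>
      obtain ⟨i, rfl⟩ := hr
      obtain ⟨x, hx, rfl⟩ := hx
      have hy : a i • (x : E) ∈ U (n + 1) :=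
        hUI n (Submodule.smul_mem_smul (ha ▸ Ideal.subset_span ⟨i, rfl⟩) x.2)
      refine ⟨⟨_, hy⟩, ?_, rfl⟩
      change q (n + 1) _ ∈ W.1 (n + 1)
      rw [← hf i n x _ rfl]
      exact W.2 i n _ hx
    | zero => simp
    | add r s _ _ hr hs => rw [add_smul]; exact add_mem hr hs
    | smul c r _ hr => rw [smul_eq_mul, mul_smul]; exact Submodule.smul_mem _ _ hr
  have hpow (W : GradedSub f) (j n : ℕ) : I ^ j • lift W n ≤ lift W (j + n) := by
    induction j with
    | zero => simp
    | succ j ih =>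
      rw [pow_succ', mul_smul, add_right_comm]
      exact (smul_mono_right _ ih).trans (hlift W _)
  let S (W : GradedSub f) : Submodule (reesAlgebra I) (PolynomialModule A E) :=
    { carrier := {p | ∀ n, p.coeff n ∈ lift W n}
      add_mem' hp hp' n := add_mem (hp n) (hp' n)
      zero_mem' n := zero_mem _
      smul_mem' r p hp i := by
        rw [Subalgebra.smul_def, PolynomialModule.smul_apply]
        refine Submodule.sum_mem _ ?_
        rintro ⟨j, k⟩ e
        obtain rfl : j + k = i := Finset.HasAntidiagonal.mem_antidiagonal.1 e
        exact hpow W j k (Submodule.smul_mem_smul (r.2 j) (hp k)) }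
  let N₀ : Submodule (reesAlgebra I) (PolynomialModule A E) :=
    (I.stableFiltration (⊤ : Submodule A E)).submodule
  have hN₀ : IsNoetherian (reesAlgebra I) N₀ :=
    isNoetherian_of_fg_of_noetherian _ <|
      (Ideal.Filtration.submodule_fg_iff_stable _ fun i ↦ IsNoetherian.noetherian _).2
        (I.stableFiltration_stable ⊤)
  let Φ (W : GradedSub f) : Submodule (reesAlgebra I) N₀ := (S W).comap N₀.subtype
  have hΦ (W W' : GradedSub f) : Φ W ≤ Φ W' ↔ W ≤ W' := by
    constructor
    · intro h n x hx
      obtain ⟨u, rfl⟩ := hq n x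
      -- Membership in degree n is tested on elements concentrated in that degree.
      have hu : PolynomialModule.single A n (u : E) ∈ N₀ := fun k ↦ by
        rw [PolynomialModule.coeff_single, Finsupp.single_apply]
        split_ifs with hk
        · exact hk ▸ hU n u.2
        · exact zero_mem _
      have hmem : (⟨_, hu⟩ : N₀) ∈ Φ W := fun k ↦ by
        rw [Submodule.subtype_apply, PolynomialModule.coeff_single, Finsupp.single_apply]
        split_ifs with hk
        · subst hk
          exact ⟨u, hx, rfl⟩
        · exact zero_mem _
      obtain ⟨u', hu', he⟩ := h hmem n
      rw [Submodule.subtype_apply, Submodule.subtype_apply, PolynomialModule.coeff_single,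
        Finsupp.single_eq_same] at he
      rwa [← Subtype.ext he]
    · intro h x hx n
      exact Submodule.map_mono (Submodule.comap_mono (h n)) (hx n)
  exact (OrderEmbedding.ofMapLEIff Φ hΦ).strictMono.wellFoundedGT

/-- The quotient `(C ∩ I ^ n E) / I ^ n C`. -/
abbrev TraceQuotient (I : Ideal A) (C : Submodule A E) (n : ℕ) : Type v :=
  ↥(C ⊓ I ^ n • ⊤) ⧸ (I ^ n • C).submoduleOf (C ⊓ I ^ n • ⊤)

lemma exists_polynomial_length_traceQuotient [IsNoetherianRing A] [Module.Finite A E]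
    (I : Ideal A) (C : Submodule A E) (h : ∀ n, Module.length A (TraceQuotient I C n) ≠ ⊤) :
    ∃ P : Polynomial ℚ, ∀ᶠ n : ℕ in Filter.atTop,
      ((Module.length A (TraceQuotient I C n)).toNat : ℚ) = P.eval (n : ℚ) := by
  obtain ⟨m, a, ha⟩ := Submodule.fg_iff_exists_fin_generating_family.1
    (IsNoetherian.noetherian I)
  have hmem (i : Fin m) : a i ∈ I := ha ▸ Submodule.subset_span ⟨i, rfl⟩
  have hUI (n : ℕ) : I • (C ⊓ I ^ n • ⊤ : Submodule A E) ≤ C ⊓ I ^ (n + 1) • ⊤ := by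
    refine (smul_inf_le _ _ _).trans (inf_le_inf Submodule.smul_le_right ?_)
    rw [pow_succ', mul_smul]
  have hmap (i : Fin m) (n : ℕ) (x : E) (hx : x ∈ C ⊓ I ^ n • ⊤) :
      LinearMap.lsmul A E (a i) x ∈ C ⊓ I ^ (n + 1) • ⊤ :=
    hUI n (Submodule.smul_mem_smul (hmem i) hx)
  let f (i : Fin m) (n : ℕ) : TraceQuotient I C n →ₗ[A] TraceQuotient I C (n + 1) :=
    Submodule.mapQ _ _ ((LinearMap.lsmul A E (a i)).restrict (hmap i n)) (by
      intro x hx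
      change a i • (x : E) ∈ I ^ (n + 1) • C
      rw [pow_succ', mul_smul]
      exact Submodule.smul_mem_smul (hmem i) hx)
  refine exists_hilbert_polynomial f (fun i j n x ↦ ?_) h ?_
  · obtain ⟨x, rfl⟩ := Submodule.mkQ_surjective _ x
    refine congrArg (Submodule.mkQ _) (Subtype.ext ?_)
    exact smul_comm (a i) (a j) (x : E)
  · exact wellFoundedGT_gradedSub_of_surjective ha.symm (fun n ↦ inf_le_right) hUI
      (fun n ↦ Submodule.mkQ _) (fun n ↦ Submodule.mkQ_surjective _) f
      fun i n x y hy ↦ congrArg (Submodule.mkQ _) (Subtype.ext hy.symm)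

end Subquotients

/-! ### Dimension of quotients of the Rees algebra. -/

section ReesDimension

open MvPolynomial

/-- The algebra map `A[X_k] → K[X_k]` that sends `X i` to `c i * X j` for `i ∈ S` and fixes the
other variables. -/
noncomputable def collapseVars (A : Type*) {K : Type*} [CommRing A] [Field K] [Algebra A K]
    {σ : Type*} [DecidableEq σ] (c : σ → K) (j : σ) (S : Finset σ) :
    MvPolynomial σ A →ₐ[A] MvPolynomial σ K :=
  aeval fun i ↦ if i ∈ S then C (c i) * X j else X i

lemma collapseVars_X_of_mem {A K σ : Type*} [CommRing A] [Field K] [Algebra A K] [DecidableEq σ]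
    {c : σ → K} {j : σ} {S : Finset σ} {i : σ} (hi : i ∈ S) :
    collapseVars A c j S (X i) = C (c i) * X j := by
  rw [collapseVars, aeval_X, if_pos hi]

lemma collapseVars_X_of_notMem {A K σ : Type*} [CommRing A] [Field K] [Algebra A K] [DecidableEq σ]
    {c : σ → K} {j : σ} {S : Finset σ} {i : σ} (hi : i ∉ S) :
    collapseVars A c j S (X i) = X i := by
  rw [collapseVars, aeval_X, if_neg hi]

lemma collapseVars_C {A K σ : Type*} [CommRing A] [Field K] [Algebra A K] [DecidableEq σ]
    {c : σ → K} {j : σ} {S : Finset σ} (x : A) :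
    collapseVars A c j S (C x) = C (algebraMap A K x) := by
  rw [collapseVars, algHom_C, MvPolynomial.algebraMap_apply]

/-- Collapsing one more variable factors through the previous collapse. Writing c_i = u/v with u, v
from A, the element v X_i - u X_j is killed only by the larger collapse. -/
lemma ker_collapseVars_lt {A K σ : Type*} [CommRing A] [Field K] [Algebra A K] [DecidableEq σ]
    (hK : ∀ x : K, ∃ u v : A, algebraMap A K v ≠ 0 ∧ algebraMap A K v * x = algebraMap A K u)
    (c : σ → K) {j : σ} {S : Finset σ} {i : σ} (hj : j ∉ S) (hij : i ≠ j) (hi : i ∉ S) :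
    RingHom.ker (collapseVars A c j S) < RingHom.ker (collapseVars A c j (insert i S)) := by
  have hj' : j ∉ insert i S := by simp [hj, Ne.symm hij]
  let τ : MvPolynomial σ K →ₐ[K] MvPolynomial σ K :=
    aeval fun k ↦ if k = i then C (c i) * X j else X k
  have hτ : collapseVars A c j (insert i S) = (τ.restrictScalars A).comp (collapseVars A c j S) := by
    refine MvPolynomial.algHom_ext fun k ↦ ?_
    rw [AlgHom.comp_apply, AlgHom.restrictScalars_apply]
    by_cases hk : k = i
    · subst hk
      rw [collapseVars_X_of_mem (Finset.mem_insert_self _ _), collapseVars_X_of_notMem hi, aeval_X,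
        if_pos rfl]
    · by_cases hk' : k ∈ S
      · rw [collapseVars_X_of_mem (Finset.mem_insert_of_mem hk'), collapseVars_X_of_mem hk',
          map_mul,
          aeval_X, if_neg (Ne.symm hij), algHom_C, algebraMap_eq]
      · rw [collapseVars_X_of_notMem (by simp [hk, hk']), collapseVars_X_of_notMem hk', aeval_X,
          if_neg hk]
  refine lt_of_le_of_ne (fun f hf ↦ ?_) fun h ↦ ?_
  · rw [RingHom.mem_ker] at hf ⊢
    rw [hτ, AlgHom.comp_apply, hf, map_zero]
  · obtain ⟨u, v, hv, huv⟩ := hK (c i)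
    have hmem : C v * X i - C u * X j ∈ RingHom.ker (collapseVars A c j (insert i S)) := by
      rw [RingHom.mem_ker, map_sub, map_mul, map_mul,
        collapseVars_X_of_mem (Finset.mem_insert_self _ _), collapseVars_X_of_notMem hj',
        collapseVars_C, collapseVars_C, ← mul_assoc, ← C_mul, huv, sub_self]
    rw [← h, RingHom.mem_ker, map_sub, map_mul, map_mul, collapseVars_X_of_notMem hi,
      collapseVars_X_of_notMem hj, collapseVars_C, collapseVars_C] at hmem
    have hc := congrArg (coeff (Finsupp.single i 1)) hmem
    rw [coeff_sub, coeff_C_mul, coeff_C_mul, coeff_X, coeff_X,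
      if_pos rfl, if_neg (by rw [Finsupp.single_left_inj one_ne_zero]; exact Ne.symm hij), mul_zero,
          sub_zero,
      mul_one, coeff_zero] at hc
    exact hv hc

/-- The kernels are prime, as K[X] is a domain, and collapsing the variables one at a time gives a
strict chain of them. -/
lemma card_le_height_ker_collapseVars {A K σ : Type*} [CommRing A] [Field K] [Algebra A K]
    [DecidableEq σ]
    (hK : ∀ x : K, ∃ u v : A, algebraMap A K v ≠ 0 ∧ algebraMap A K v * x = algebraMap A K u)
    (c : σ → K) {j : σ} (S : Finset σ) (hj : j ∉ S) :
    (S.card : ℕ∞) ≤ (RingHom.ker (collapseVars A c j S)).height := by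
  induction S using Finset.induction_on with
  | empty => simp
  | insert i S hi ih =>
    rw [Finset.mem_insert, not_or] at hj
    rw [Finset.card_insert_of_notMem hi, Nat.cast_add, Nat.cast_one]
    have : (RingHom.ker (collapseVars A c j S)).IsPrime := RingHom.ker_isPrime _
    have : (RingHom.ker (collapseVars A c j (insert i S))).IsPrime := RingHom.ker_isPrime _
    exact (add_le_add (ih hj.2) le_rfl).trans (Ideal.height_add_one_le_of_lt_of_isPrime
      (ker_collapseVars_lt hK c hj.2 (Ne.symm hj.1) hi))

/-- Over K all a_i are multiples of a_j, so X_i ↦ a_i t factors through collapsing every variable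
onto X_j. -/
lemma map_aeval_monomial_eq_zero {A K σ : Type*} [CommRing A] [Field K] [Algebra A K] [Fintype σ]
    [DecidableEq σ] (a : σ → A) {c : σ → K} {j : σ}
    (hc : ∀ i, algebraMap A K (a i) = c i * algebraMap A K (a j)) {f : MvPolynomial σ A}
    (hf : collapseVars A c j (Finset.univ.erase j) f = 0) :
    Polynomial.mapRingHom (algebraMap A K) (aeval (fun i ↦ Polynomial.monomial 1 (a i)) f) = 0 := by
  let τ : MvPolynomial σ K →ₐ[K] Polynomial K :=
    aeval fun i ↦ Polynomial.monomial 1 (algebraMap A K (a i))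
  have hτ : (τ.restrictScalars A).comp (collapseVars A c j (Finset.univ.erase j)) =
      (Polynomial.mapAlg A K).comp (aeval fun i ↦ Polynomial.monomial 1 (a i)) := by
    refine MvPolynomial.algHom_ext fun k ↦ ?_
    rw [AlgHom.comp_apply, AlgHom.restrictScalars_apply, AlgHom.comp_apply, aeval_X,
      Polynomial.mapAlg_eq_map, Polynomial.map_monomial]
    by_cases hk : k = j
    · rw [collapseVars_X_of_notMem (by simp [hk]), aeval_X]
    · rw [collapseVars_X_of_mem (by simp [hk]), map_mul, aeval_X, algHom_C,
        Polynomial.algebraMap_eq, Polynomial.C_mul_monomial, ← hc]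
  have := DFunLike.congr_fun hτ f
  rw [AlgHom.comp_apply, AlgHom.comp_apply, hf, map_zero, Polynomial.mapAlg_eq_map] at this
  exact this.symm

/-- A minimal prime W over the kernel is contracted from a prime 𝔓 of A[t]. With K the fraction
field of A/(𝔓 ∩ A), the kernel of the collapse onto one variable lies in W, hence in P, and has
height at least m. -/
lemma le_height_of_ker_aeval_monomial_le {A : Type*} [CommRing A] {m : ℕ} (a : Fin (m + 1) → A)
    (P : Ideal (MvPolynomial (Fin (m + 1)) A)) [P.IsPrime]
    (hP : RingHom.ker (aeval (R := A) fun i ↦ Polynomial.monomial 1 (a i)) ≤ P) :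
    (m : ℕ∞) ≤ P.height := by
  classical
  obtain ⟨W, hW, hWP⟩ := Ideal.exists_minimalPrimes_le hP
  obtain ⟨𝔓, h𝔓, -, rfl⟩ := Ideal.exists_comap_eq_of_mem_minimalPrimes
    (f := (aeval (R := A) fun i ↦ Polynomial.monomial 1 (a i)).toRingHom) (I := ⊥) W hW
  let p : Ideal A := 𝔓.comap Polynomial.C
  let K := FractionRing (A ⧸ p)
  have hker : RingHom.ker (algebraMap A K) = p := by
    rw [IsScalarTower.algebraMap_eq A (A ⧸ p) K, RingHom.ker_comp_of_injective _
      (IsFractionRing.injective (A ⧸ p) K)]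
    exact Ideal.mk_ker
  have hK (x : K) : ∃ u v : A, algebraMap A K v ≠ 0 ∧ algebraMap A K v * x = algebraMap A K u := by
    obtain ⟨x, y, hy, rfl⟩ := IsFractionRing.div_surjective (A := A ⧸ p) x
    obtain ⟨u, rfl⟩ := Ideal.Quotient.mk_surjective x
    obtain ⟨v, rfl⟩ := Ideal.Quotient.mk_surjective y
    have hv : algebraMap A K v ≠ 0 := fun hv ↦ by
      have : v ∈ p := by rwa [← hker]
      rw [Ideal.Quotient.eq_zero_iff_mem.2 this] at hy
      exact zero_notMem_nonZeroDivisors hy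
    exact ⟨u, v, hv, mul_div_cancel₀ _ hv⟩
  obtain ⟨j, c, hc⟩ : ∃ (j : Fin (m + 1)) (c : Fin (m + 1) → K),
      ∀ i, algebraMap A K (a i) = c i * algebraMap A K (a j) := by
    by_cases h : ∃ j, algebraMap A K (a j) ≠ 0
    · obtain ⟨j, hj⟩ := h
      exact ⟨j, fun i ↦ algebraMap A K (a i) / algebraMap A K (a j), fun i ↦
        (div_mul_cancel₀ _ hj).symm⟩
    · push Not at h
      exact ⟨0, 0, fun i ↦ by rw [h, Pi.zero_apply, zero_mul]⟩
  have hle : RingHom.ker (collapseVars A c j (Finset.univ.erase j)) ≤ P := by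
    refine le_trans (fun f hf ↦ ?_) hWP
    have h0 := map_aeval_monomial_eq_zero a hc (RingHom.mem_ker.1 hf)
    rw [← RingHom.mem_ker, Polynomial.ker_mapRingHom, hker] at h0
    exact (Ideal.map_comap_le (f := Polynomial.C) (K := 𝔓)) h0
  calc (m : ℕ∞) = ((Finset.univ.erase j).card : ℕ∞) := by simp
    _ ≤ _ := card_le_height_ker_collapseVars hK c _ (Finset.notMem_erase _ _)
    _ ≤ _ := Ideal.height_mono hle

/-- A chain of primes of F pulls back to the polynomial ring, where its bottom has height at least
m. Splicing a chain of length m below it must fit into dimension d + m + 1. -/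
lemma ringKrullDim_le_of_ker_aeval_monomial_le {A : Type*} [CommRing A] [IsNoetherianRing A]
    {d : ℕ} (hd : ringKrullDim A = d) {m : ℕ} (a : Fin (m + 1) → A) {F : Type*} [CommRing F]
    (π : MvPolynomial (Fin (m + 1)) A →+* F) (hπ : Function.Surjective π)
    (h : RingHom.ker (aeval (R := A) fun i ↦ Polynomial.monomial 1 (a i)) ≤ RingHom.ker π) :
    ringKrullDim F ≤ (d + 1 : ℕ) := by
  refine iSup_le fun l ↦ ?_
  let q := l.map (PrimeSpectrum.comap π) fun x y hxy ↦
    lt_of_le_of_ne (Ideal.comap_mono hxy.le) fun h ↦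
      hxy.ne (PrimeSpectrum.comap_injective_of_surjective π hπ h)
  have h1 : (m : ℕ∞) ≤ Order.height q.head := by
    rw [← PrimeSpectrum.height_eq_orderHeight]
    exact le_height_of_ker_aeval_monomial_le a _ (h.trans (Ideal.comap_mono bot_le))
  obtain ⟨q', hq', hm⟩ := Order.exists_series_of_le_height _ h1
  have h2 := Order.LTSeries.length_le_krullDim (q'.smash q hq')
  have h3 : ringKrullDim (MvPolynomial (Fin (m + 1)) A) = (d + (m + 1) : ℕ) := by
    rw [MvPolynomial.ringKrullDim_of_isNoetherianRing, hd]
    simp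
  rw [← ringKrullDim, h3] at h2
  have h4 : (q'.smash q hq').length = q'.length + l.length := rfl
  have h5 : q'.length + l.length ≤ d + (m + 1) := by
    rw [h4] at h2
    exact_mod_cast h2
  exact_mod_cast (by omega : l.length ≤ d + 1)

lemma ringKrullDim_le_of_isIntegral {R S : Type*} [CommRing R] [CommRing S] [Algebra R S]
    [Algebra.IsIntegral R S] (h : Function.Injective (algebraMap R S)) :
    ringKrullDim R ≤ ringKrullDim S := by
  refine iSup_le fun l ↦ ?_
  obtain ⟨Q, -, hQ, hQl⟩ := Ideal.exists_ideal_over_prime_of_isIntegral l.head.asIdeal (⊥ : Ideal S)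
    (by rw [← RingHom.ker_eq_comap_bot, (RingHom.injective_iff_ker_eq_bot _).1 h]; exact bot_le)
  have : Q.LiesOver l.head.asIdeal := ⟨hQl.symm⟩
  obtain ⟨L, hL, -⟩ := Ideal.exists_ltSeries_of_hasGoingUp l Q
  rw [← hL]
  exact Order.LTSeries.length_le_krullDim L

end ReesDimension

/-! ### Growth of powers of a finite dimensional subspace. -/

section Growth

open scoped Pointwise

variable {k F : Type*} [Field k] [CommRing F] [Algebra k F]

lemma Submodule.span_one_pair_pow_le [DecidableEq F] (y : F) (c : ℕ) :
    span k {1, y} ^ c ≤ span k ((Finset.range (c + 1)).image (y ^ ·) : Set F) := by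
  induction c with
  | zero => simp [Submodule.one_eq_span]
  | succ c ih =>
    rw [pow_succ]
    refine (mul_le_mul' ih le_rfl).trans ?_
    rw [Submodule.span_mul_span, Submodule.span_le]
    rintro _ ⟨_, hx, z, hz, rfl⟩
    rw [Finset.mem_coe, Finset.mem_image] at hx
    obtain ⟨i, hi, rfl⟩ := hx
    rw [Finset.mem_range] at hi
    refine Submodule.subset_span ?_
    rw [Finset.mem_coe, Finset.mem_image]
    obtain rfl | rfl := hz
    · exact ⟨i, Finset.mem_range.2 (by omega), (mul_one _).symm⟩
    · exact ⟨i + 1, Finset.mem_range.2 (by omega), pow_succ _ _⟩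

lemma Submodule.exists_finset_prod_span_one_pair_pow_le [DecidableEq F] {ι : Type*} (y : ι → F)
    (c : ℕ) (s : Finset ι) :
    ∃ t : Finset F, (∏ j ∈ s, span k {1, y j}) ^ c ≤ span k (t : Set F) ∧
      t.card ≤ (c + 1) ^ s.card := by
  classical
  induction s using Finset.induction_on with
  | empty => exact ⟨{1}, by simp [← Submodule.one_eq_span], by simp⟩
  | insert j s hj ih =>
    obtain ⟨t, ht, hc⟩ := ih
    refine ⟨(Finset.range (c + 1)).image (y j ^ ·) * t, ?_, ?_⟩
    · rw [Finset.prod_insert hj, mul_pow, Finset.coe_mul, ← Submodule.span_mul_span]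
      exact mul_le_mul' (Submodule.span_one_pair_pow_le _ _) ht
    · rw [Finset.card_insert_of_notMem hj, pow_succ']
      refine Finset.card_mul_le.trans (Nat.mul_le_mul ?_ hc)
      exact Finset.card_image_le.trans (Finset.card_range _).le

/-- With Y the product of the spans of 1 and y_j, and B spanned by 1 and module generators, F is the
union of the Y^c B. From T ≤ Y^c₁ B and B B ≤ Y^c₂ B follows T^n ≤ Y^((c₁+c₂)n) B, and Y^c is
spanned by at most (c+1)^s monomials. -/
lemma exists_finset_pow_le_of_finite {s : ℕ} (g : MvPolynomial (Fin s) k →ₐ[k] F) (hg : g.Finite)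
    (T : Submodule k F) (hT : T.FG) :
    ∃ C : ℕ, ∀ n, ∃ t : Finset F, T ^ n ≤ Submodule.span k (t : Set F) ∧
      t.card ≤ C * (n + 1) ^ s := by
  classical
  let _ : Algebra (MvPolynomial (Fin s) k) F := g.toRingHom.toAlgebra
  have : Module.Finite (MvPolynomial (Fin s) k) F := hg
  obtain ⟨b, hb⟩ := Module.Finite.fg_top (R := MvPolynomial (Fin s) k) (M := F)
  let Y : Submodule k F := ∏ j, Submodule.span k {1, g (MvPolynomial.X j)}
  let B : Submodule k F := Submodule.span k (insert 1 b : Finset F)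
  have hZ (j : Fin s) : 1 ≤ Submodule.span k {1, g (MvPolynomial.X j)} :=
    Submodule.one_le.2 (Submodule.subset_span (by simp))
  have hY : 1 ≤ Y := Finset.one_le_prod' fun j _ ↦ hZ j
  have hYX (j : Fin s) : g (MvPolynomial.X j) ∈ Y :=
    Finset.single_le_prod' (f := fun j ↦ Submodule.span k {1, g (MvPolynomial.X j)})
      (fun j _ ↦ hZ j) (Finset.mem_univ j) (Submodule.subset_span (by simp))
  have hYmono {c e : ℕ} (h : c ≤ e) : Y ^ c ≤ Y ^ e := pow_le_pow_right' hY h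
  have hmono {c e : ℕ} (h : c ≤ e) : Y ^ c * B ≤ Y ^ e * B := mul_le_mul' (hYmono h) le_rfl
  have hB : 1 ≤ B := Submodule.one_le.2 (Submodule.subset_span (by simp))
  have hYg (f : MvPolynomial (Fin s) k) : ∃ c, g f ∈ Y ^ c := by
    induction f using MvPolynomial.induction_on with
    | C x => exact ⟨0, by rw [MvPolynomial.algHom_C, pow_zero]; exact Submodule.algebraMap_mem x⟩
    | add p q hp hq =>
      obtain ⟨c, hc⟩ := hp
      obtain ⟨e, he⟩ := hq
      exact ⟨max c e, by
        rw [map_add]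
        exact add_mem (hYmono (le_max_left _ _) hc) (hYmono (le_max_right _ _) he)⟩
    | mul_X p j hp =>
      obtain ⟨c, hc⟩ := hp
      exact ⟨c + 1, by rw [map_mul, pow_succ]; exact Submodule.mul_mem_mul hc (hYX j)⟩
  have hH (x : F) : ∃ c, x ∈ Y ^ c * B := by
    have hx : x ∈ Submodule.span (MvPolynomial (Fin s) k) (b : Set F) := hb ▸ Submodule.mem_top
    induction hx using Submodule.span_induction with
    | mem x hx =>
      refine ⟨0, ?_⟩
      rw [pow_zero, one_mul]
      exact Submodule.subset_span (by simpa using Or.inr hx)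
    | zero => exact ⟨0, zero_mem _⟩
    | add x y _ _ hx hy =>
      obtain ⟨c, hc⟩ := hx
      obtain ⟨e, he⟩ := hy
      exact ⟨max c e, add_mem (hmono (le_max_left _ _) hc) (hmono (le_max_right _ _) he)⟩
    | smul p x _ hx =>
      obtain ⟨c, hc⟩ := hx
      obtain ⟨e, he⟩ := hYg p
      refine ⟨e + c, ?_⟩
      rw [pow_add, mul_assoc, Algebra.smul_def]
      exact Submodule.mul_mem_mul he hc
  have hHfin (t : Finset F) : ∃ c, ∀ x ∈ t, x ∈ Y ^ c * B := by
    choose c hc using hH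
    exact ⟨t.sup c, fun x hx ↦ hmono (Finset.le_sup hx) (hc x)⟩
  have hHfg (V : Submodule k F) (hV : V.FG) : ∃ c, V ≤ Y ^ c * B := by
    obtain ⟨t, rfl⟩ := hV
    obtain ⟨c, hc⟩ := hHfin t
    exact ⟨c, Submodule.span_le.2 hc⟩
  obtain ⟨c₁, h₁⟩ := hHfg T hT
  have hBfg : B.FG := ⟨_, rfl⟩
  obtain ⟨c₂, h₂⟩ := hHfg (B * B) (hBfg.mul hBfg)
  have hpow (n : ℕ) : T ^ n ≤ Y ^ ((c₁ + c₂) * n) * B := by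
    induction n with
    | zero => simpa using hB
    | succ n ih =>
      calc T ^ (n + 1) ≤ (Y ^ ((c₁ + c₂) * n) * B) * (Y ^ c₁ * B) := by
            rw [pow_succ]
            exact mul_le_mul' ih h₁
        _ = Y ^ ((c₁ + c₂) * n + c₁) * (B * B) := by ring
        _ ≤ Y ^ ((c₁ + c₂) * n + c₁) * (Y ^ c₂ * B) := mul_le_mul' le_rfl h₂
        _ = Y ^ ((c₁ + c₂) * (n + 1)) * B := by ring
  refine ⟨(c₁ + c₂ + 1) ^ s * (insert 1 b : Finset F).card, fun n ↦ ?_⟩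
  obtain ⟨t, ht, hc⟩ := Submodule.exists_finset_prod_span_one_pair_pow_le (k := k)
    (fun j ↦ g (MvPolynomial.X j)) ((c₁ + c₂) * n) Finset.univ
  refine ⟨t * insert 1 b, (hpow n).trans ?_, Finset.card_mul_le.trans ?_⟩
  · rw [Finset.coe_mul, ← Submodule.span_mul_span]
    exact mul_le_mul' ht le_rfl
  · rw [Finset.card_univ, Fintype.card_fin] at hc
    calc t.card * (insert 1 b : Finset F).card ≤ ((c₁ + c₂) * n + 1) ^ s * (insert 1 b).card :=
          Nat.mul_le_mul_right _ hc
      _ ≤ ((c₁ + c₂ + 1) * (n + 1)) ^ s * (insert 1 b).card := by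
          gcongr
          nlinarith
      _ = _ := by rw [mul_pow]; ring

/-- Noether normalization: F is finite over a polynomial ring in s variables, and s is at most dim F
by going up. -/
lemma exists_finrank_pow_le [Algebra.FiniteType k F] {D : ℕ} (hD : ringKrullDim F ≤ D)
    (T : Submodule k F) (hT : T.FG) :
    ∃ C : ℕ, ∀ n, Module.finrank k ↥(T ^ n) ≤ C * (n + 1) ^ D := by
  nontriviality F
  obtain ⟨s, g, hinj, hfin⟩ := exists_finite_inj_algHom_of_fg k F
  have hs : s ≤ D := by
    let _ : Algebra (MvPolynomial (Fin s) k) F := g.toRingHom.toAlgebra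
    have : Module.Finite (MvPolynomial (Fin s) k) F := hfin
    have h1 := (ringKrullDim_le_of_isIntegral (R := MvPolynomial (Fin s) k) (S := F) hinj).trans hD
    rw [MvPolynomial.ringKrullDim_of_isNoetherianRing, ringKrullDim_eq_zero_of_field, zero_add,
      Nat.card_eq_fintype_card, Fintype.card_fin] at h1
    exact_mod_cast h1
  obtain ⟨C, hC⟩ := exists_finset_pow_le_of_finite g hfin T hT
  refine ⟨C, fun n ↦ ?_⟩
  obtain ⟨t, ht, hc⟩ := hC n
  calc Module.finrank k ↥(T ^ n) ≤ Module.finrank k (Submodule.span k (t : Set F)) :=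
        Submodule.finrank_mono ht
    _ ≤ t.card := finrank_span_finset_le_card t
    _ ≤ C * (n + 1) ^ s := hc
    _ ≤ C * (n + 1) ^ D := by gcongr; omega

end Growth

/-! ### Numbers of generators of the powers of I through the fiber cone. -/

section FiberCone

open IsLocalRing

variable {A : Type*} [CommRing A] [IsLocalRing A]

lemma Submodule.FG.exists_minimal_generators {M : Type*} [AddCommGroup M] [Module A M]
    {N : Submodule A M} (hN : N.FG) :
    ∃ x : Fin N.spanFinrank → N, ∀ α : Fin N.spanFinrank → A,
      ∑ i, α i • (x i : M) ∈ maximalIdeal A • N → ∀ i, α i ∈ maximalIdeal A := by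
  let _ : Field (A ⧸ maximalIdeal A) := Ideal.Quotient.field _
  have : Module.Finite A N := Module.Finite.iff_fg.2 hN
  have : Module.Finite (A ⧸ maximalIdeal A) (N ⧸ maximalIdeal A • (⊤ : Submodule A N)) :=
    Module.Finite.of_restrictScalars_finite A _ _
  let b := Module.finBasisOfFinrankEq (A ⧸ maximalIdeal A)
    (N ⧸ maximalIdeal A • (⊤ : Submodule A N)) (spanFinrank_eq_finrank_quotient N hN).symm
  choose x hx using fun i ↦ Submodule.mkQ_surjective _ (b i)
  refine ⟨x, fun α hα i ↦ ?_⟩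
  rw [← Ideal.Quotient.eq_zero_iff_mem]
  refine Fintype.linearIndependent_iff.1 b.linearIndependent
    (fun i ↦ Ideal.Quotient.mk _ (α i)) ?_ i
  have h : ∑ i, α i • x i ∈ maximalIdeal A • (⊤ : Submodule A N) := by
    rw [Submodule.mem_smul_top_iff]
    simpa using hα
  rw [← Submodule.ker_mkQ (maximalIdeal A • (⊤ : Submodule A N)), LinearMap.mem_ker, map_sum] at h
  rw [← h]
  refine Finset.sum_congr rfl fun i _ ↦ ?_
  rw [map_smul, hx]
  rfl

lemma coeff_mem_of_mem_map_reesAlgebra {A : Type*} [CommRing A] {I J : Ideal A} {z : reesAlgebra I}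
    (hz : z ∈ J.map (algebraMap A (reesAlgebra I))) (n : ℕ) :
    (z : Polynomial A).coeff n ∈ J * I ^ n := by
  induction hz using Submodule.span_induction generalizing n with
  | mem z hz =>
    obtain ⟨x, hx, rfl⟩ := hz
    rw [Subalgebra.coe_algebraMap, Polynomial.algebraMap_eq, Polynomial.coeff_C]
    split_ifs with hn
    · simpa [hn] using hx
    · exact zero_mem _
  | zero => simp
  | add x y _ _ hx hy => simpa using add_mem (hx n) (hy n)
  | smul r z _ hz =>
    rw [smul_eq_mul, Subalgebra.coe_mul, Polynomial.coeff_mul]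
    refine sum_mem ?_
    rintro ⟨i, j⟩ hij
    obtain rfl := Finset.HasAntidiagonal.mem_antidiagonal.1 hij
    have := Ideal.mul_mem_mul (r.2 i) (hz j)
    rwa [← mul_assoc, mul_comm (I ^ i) J, mul_assoc, ← pow_add] at this

/-- The element `x t ^ n` of the Rees algebra, for `x ∈ I ^ n`. -/
noncomputable def reesMonomial {A : Type*} [CommRing A] (I : Ideal A) (n : ℕ) :
    ↥(I ^ n) →ₗ[A] reesAlgebra I :=
  ((Polynomial.monomial n).comp (I ^ n).subtype).codRestrict
    (Subalgebra.toSubmodule (reesAlgebra I)) fun x ↦ reesAlgebra.monomial_mem.2 x.2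

lemma coe_reesMonomial {A : Type*} [CommRing A] (I : Ideal A) (n : ℕ) (x : ↥(I ^ n)) :
    (reesMonomial I n x : Polynomial A) = Polynomial.monomial n (x : A) := rfl

lemma map_reesMonomial_mem_pow {A k F : Type*} [CommRing A] [CommRing k] [CommRing F] [Algebra k F]
    {I : Ideal A} (ρ : reesAlgebra I →+* F) {T : Submodule k F}
    (h0 : ∀ x, ρ (reesMonomial I 0 x) ∈ (1 : Submodule k F))
    (hT : ∀ x, ρ (reesMonomial I 1 x) ∈ T) (n : ℕ) (x : ↥(I ^ n)) :
    ρ (reesMonomial I n x) ∈ T ^ n := by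
  induction n with
  | zero => simpa using h0 x
  | succ n ih =>
    obtain ⟨x, hx⟩ := x
    have hx' := hx
    rw [pow_succ] at hx'
    induction hx' using Submodule.mul_induction_on' with
    | mem_mul_mem y hy z hz =>
      have : reesMonomial I (n + 1) ⟨y * z, hx⟩ =
          reesMonomial I n ⟨y, hy⟩ * reesMonomial I 1 ⟨z, by rwa [pow_one]⟩ := by
        refine Subtype.ext ?_
        rw [Subalgebra.coe_mul, coe_reesMonomial, coe_reesMonomial, coe_reesMonomial,
          Polynomial.monomial_mul_monomial]
      rw [this, map_mul, pow_succ]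
      exact Submodule.mul_mem_mul (ih _) (hT _)
    | add y hy z hz h1 h2 =>
      rw [← pow_succ] at hy hz
      have : (⟨y + z, hx⟩ : ↥(I ^ (n + 1))) = ⟨y, hy⟩ + ⟨z, hz⟩ := rfl
      rw [this, map_add, map_add]
      exact add_mem (h1 hy) (h2 hz)

lemma ringKrullDim_le_of_surjective_reesAlgebra {A : Type*} [CommRing A] [IsNoetherianRing A]
    {d : ℕ} (hd : ringKrullDim A = d) {I : Ideal A} {F : Type*} [CommRing F]
    (ρ : reesAlgebra I →+* F) (hρ : Function.Surjective ρ) : ringKrullDim F ≤ (d + 1 : ℕ) := by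
  obtain ⟨m, a, ha⟩ := Submodule.fg_iff_exists_fin_generating_family.1 (IsNoetherian.noetherian I)
  have hmem (i : Fin m) : a i ∈ I := ha ▸ Submodule.subset_span ⟨i, rfl⟩
  -- A redundant zero generator is prepended so that there is at least one variable, even for I = 0.
  have hmem' (i : Fin (m + 1)) : (Fin.cons 0 a : Fin (m + 1) → A) i ∈ I ^ 1 := by
    rw [pow_one]
    refine Fin.cases (zero_mem _) hmem i
  let ψ : MvPolynomial (Fin (m + 1)) A →ₐ[A] reesAlgebra I :=
    MvPolynomial.aeval fun i ↦ reesMonomial I 1 ⟨_, hmem' i⟩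
  have hψ : (reesAlgebra I).val.comp ψ = MvPolynomial.aeval (R := A) fun i ↦
      Polynomial.monomial 1 ((Fin.cons 0 a : Fin (m + 1) → A) i) :=
    MvPolynomial.algHom_ext fun i ↦ by
      rw [AlgHom.comp_apply, MvPolynomial.aeval_X, MvPolynomial.aeval_X]
      rfl
  have hψs : Function.Surjective ψ := by
    rintro ⟨z, hz⟩
    rw [← adjoin_monomial_eq_reesAlgebra, ← ha, Submodule.map_span, Algebra.adjoin_span] at hz
    have hle : Algebra.adjoin A ((Polynomial.monomial 1 : A →ₗ[A] Polynomial A) '' Set.range a) ≤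
        ((reesAlgebra I).val.comp ψ).range := by
      refine Algebra.adjoin_le ?_
      rintro _ ⟨_, ⟨i, rfl⟩, rfl⟩
      refine ⟨MvPolynomial.X i.succ, ?_⟩
      rw [hψ]
      exact (MvPolynomial.aeval_X _ _).trans (by rw [Fin.cons_succ])
    obtain ⟨f, hf⟩ := hle hz
    exact ⟨f, Subtype.ext hf⟩
  refine ringKrullDim_le_of_ker_aeval_monomial_le hd (Fin.cons 0 a)
    (ρ.comp (ψ : _ →+* reesAlgebra I)) (hρ.comp hψs) fun f hf ↦ ?_
  rw [RingHom.mem_ker, ← hψ, AlgHom.comp_apply] at hf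
  have h0 : ψ f = 0 := Subtype.ext hf
  rw [RingHom.mem_ker, RingHom.comp_apply]
  exact (congrArg ρ h0).trans (map_zero ρ)

/-- Minimal generators of I^j, placed in degree j for all j ≤ n, have linearly independent images in
the fiber cone. All these images lie in T^n, where T is spanned by 1 and the degree one generators,
so the growth of T^n bounds their number. -/
lemma exists_sum_spanFinrank_pow_le_of_ringHom [IsNoetherianRing A] {k F : Type*} [Field k]
    [CommRing F] [Algebra k F] [Algebra.FiniteType k F] {D : ℕ} (hD : ringKrullDim F ≤ D)
    {κ : A →+* k} (hκ : Function.Surjective κ) (hκker : RingHom.ker κ = maximalIdeal A)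
        {I : Ideal A}
    {ρ : reesAlgebra I →+* F} (hρ : ∀ (α : A) (z : reesAlgebra I), ρ (α • z) = κ α • ρ z)
    (hρker : RingHom.ker ρ = (maximalIdeal A).map (algebraMap A (reesAlgebra I))) :
    ∃ C : ℕ, ∀ n, ∑ j ∈ Finset.range (n + 1), (I ^ j).spanFinrank ≤ C * (n + 1) ^ D := by
  obtain ⟨S, hS⟩ := IsNoetherian.noetherian I
  have hmem (x : S) : (x : A) ∈ I ^ 1 := by
    rw [pow_one, ← hS]
    exact Submodule.subset_span x.2
  let T : Submodule k F :=
    Submodule.span _ (insert 1 (Set.range fun x : S ↦ ρ (reesMonomial I 1 ⟨x, hmem x⟩)))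
  have hTfg : T.FG := Submodule.fg_span ((Set.finite_range _).insert _)
  have h1T : 1 ≤ T := Submodule.one_le.2 (Submodule.subset_span (Set.mem_insert _ _))
  have hT (x : ↥(I ^ 1)) : ρ (reesMonomial I 1 x) ∈ T := by
    obtain ⟨x, hx⟩ := x
    have hx' := hx
    rw [pow_one, ← hS] at hx'
    induction hx' using Submodule.span_induction with
    | mem x h => exact Submodule.subset_span (Set.mem_insert_of_mem _ ⟨⟨x, h⟩, rfl⟩)
    | zero =>
      have : (⟨0, hx⟩ : ↥(I ^ 1)) = 0 := rfl
      rw [this, map_zero, map_zero]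
      exact zero_mem _
    | add y z hy hz h1 h2 =>
      change y ∈ Submodule.span A _ at hy
      change z ∈ Submodule.span A _ at hz
      rw [hS, ← pow_one I] at hy hz
      have : (⟨y + z, hx⟩ : ↥(I ^ 1)) = ⟨y, hy⟩ + ⟨z, hz⟩ := rfl
      rw [this, map_add, map_add]
      exact add_mem (h1 hy) (h2 hz)
    | smul α y hy h =>
      change y ∈ Submodule.span A _ at hy
      rw [hS, ← pow_one I] at hy
      have : (⟨α • y, hx⟩ : ↥(I ^ 1)) = α • ⟨y, hy⟩ := rfl
      rw [this, map_smul, hρ]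
      exact Submodule.smul_mem _ _ (h hy)
  have h0 (x : ↥(I ^ 0)) : ρ (reesMonomial I 0 x) ∈
      (1 : Submodule k F) :=
    Submodule.mem_one.2 ⟨κ x, by
      rw [Algebra.algebraMap_eq_smul_one, ← map_one ρ, ← hρ]
      refine congrArg ρ (Subtype.ext ?_)
      rw [coe_reesMonomial, Subalgebra.coe_smul, Subalgebra.coe_one, Polynomial.monomial_zero_left,
        Polynomial.smul_eq_C_mul, mul_one]⟩
  obtain ⟨C, hC⟩ := exists_finrank_pow_le hD T hTfg
  refine ⟨C, fun n ↦ le_trans ?_ (hC n)⟩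
  choose x hx using fun j ↦ (IsNoetherian.noetherian (I ^ j)).exists_minimal_generators
  let v (p : Σ j : Fin (n + 1), Fin (I ^ (j : ℕ)).spanFinrank) : ↥(T ^ n) :=
    ⟨ρ (reesMonomial I p.1 (x p.1 p.2)), pow_le_pow_right' h1T (Nat.lt_succ_iff.1 p.1.2)
      (map_reesMonomial_mem_pow ρ h0 hT _ _)⟩
  have hv : LinearIndependent k v := by
    refine Fintype.linearIndependent_iff.2 fun c hc ↦ ?_
    choose α hα using fun p ↦ hκ (c p)
    have hmem : ∑ p, α p • reesMonomial I p.1 (x p.1 p.2) ∈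
        (maximalIdeal A).map (algebraMap A (reesAlgebra I)) := by
      rw [← hρker, RingHom.mem_ker, map_sum, ← (T ^ n).coe_zero, ← hc,
          AddSubmonoidClass.coe_finsetSum]
      refine Finset.sum_congr rfl fun p _ ↦ ?_
      rw [hρ, hα]
      rfl
    rintro ⟨j, i⟩
    rw [← hα, ← RingHom.mem_ker, hκker]
    refine hx j (fun i ↦ α ⟨j, i⟩) ?_ i
    -- The degree j coefficient of a relation lies in the maximal ideal times I^j, so minimality of
    -- the generators applies degree by degree.
    have := coeff_mem_of_mem_map_reesAlgebra hmem j
    rw [AddSubmonoidClass.coe_finsetSum, Polynomial.finsetSum_coeff, Fintype.sum_sigma,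
      Finset.sum_eq_single j] at this
    · simpa [coe_reesMonomial] using this
    · intro j' _ hj'
      refine Finset.sum_eq_zero fun i _ ↦ ?_
      simp [coe_reesMonomial, Polynomial.coeff_monomial, Fin.val_inj, hj']
    · simp
  have : Module.Finite k ↥(T ^ n) := Module.Finite.iff_fg.2 (hTfg.pow n)
  have hcard := hv.fintype_card_le_finrank
  rw [Fintype.card_sigma] at hcard
  rw [← Fin.sum_univ_eq_sum_range (fun j ↦ (I ^ j).spanFinrank)]
  simpa using hcard

universe v w in
lemma exists_residue_algebra {A : Type v} [CommRing A] [IsLocalRing A] (R : Type w) [CommRing R]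
    [Algebra A R] [Algebra.FiniteType A R] :
    ∃ (k : Type v) (F : Type w) (_ : Field k) (_ : CommRing F) (_ : Algebra k F) (κ : A →+* k)
        (ρ : R →+* F),
      Algebra.FiniteType k F ∧ Function.Surjective κ ∧ RingHom.ker κ = maximalIdeal A ∧
      Function.Surjective ρ ∧ RingHom.ker ρ = (maximalIdeal A).map (algebraMap A R) ∧
      ∀ (α : A) (z : R), ρ (α • z) = κ α • ρ z := by
  refine ⟨A ⧸ maximalIdeal A, R ⧸ (maximalIdeal A).map (algebraMap A R), Ideal.Quotient.field _,
    inferInstance, Ideal.Quotient.algebraQuotientMapQuotient, Ideal.Quotient.mk _,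
    Ideal.Quotient.mk _, Algebra.FiniteType.of_restrictScalars_finiteType A _ _,
    Ideal.Quotient.mk_surjective, Ideal.mk_ker, Ideal.Quotient.mk_surjective, Ideal.mk_ker,
    fun α z ↦ ?_⟩
  rw [Algebra.smul_def, map_mul, Algebra.smul_def]
  rfl

/-- The crude bound d + 1 for the dimension of the fiber cone, inherited from the Rees algebra,
suffices: passing from sums to terms later gains one degree. -/
theorem exists_sum_spanFinrank_pow_le [IsNoetherianRing A] {d : ℕ} (hd : ringKrullDim A = d)
    (I : Ideal A) :
    ∃ C : ℕ, ∀ n, ∑ j ∈ Finset.range (n + 1), (I ^ j).spanFinrank ≤ C * (n + 1) ^ (d + 1) := by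
  obtain ⟨k, F, _, _, _, κ, ρ, _, hκ, hκker, hρs, hρker, hρ⟩ :=
    exists_residue_algebra (A := A) (reesAlgebra I)
  exact exists_sum_spanFinrank_pow_le_of_ringHom
    (ringKrullDim_le_of_surjective_reesAlgebra hd ρ hρs) hκ hκker hρ hρker

end FiberCone

/-! ### Bounding the degree of the Hilbert polynomial. -/

section DegreeBound

open Polynomial Filter

lemma Polynomial.degree_le_of_eval_le {R : ℚ[X]} {D : ℕ} {C : ℚ}
    (h : ∀ᶠ n : ℕ in atTop, |R.eval (n : ℚ)| ≤ C * ((n : ℚ) + 1) ^ D) : R.degree ≤ D := by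
  by_contra! hdeg
  have hQ : ((X + 1 : ℚ[X]) ^ D).degree = D := by
    rw [degree_pow, ← C_1, degree_X_add_C, nsmul_one]
  have hQ0 : (X + 1 : ℚ[X]) ^ D ≠ 0 := fun h0 ↦ by simp [h0] at hQ
  have h1 := (abs_div_tendsto_atTop_atTop_of_degree_gt R _ (hQ ▸ hdeg) hQ0).comp
    (tendsto_natCast_atTop_atTop (R := ℚ))
  obtain ⟨n, hn1, hn2⟩ := (h.and (h1.eventually_gt_atTop C)).exists
  rw [Function.comp_apply, abs_div, eval_pow, eval_add, eval_X, eval_one,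
    abs_of_pos (by positivity : (0 : ℚ) < ((n : ℚ) + 1) ^ D), lt_div_iff₀ (by positivity)] at hn2
  exact absurd hn1 (not_le.2 hn2)

lemma Polynomial.degree_taylor_one_sub_lt {R : ℚ[X]} (hR : R ≠ 0) :
    (taylor 1 R - R).degree < R.degree := by
  have h := degree_sub_lt_left (p := taylor 1 R) (q := R) (degree_taylor R 1)
    (fun h ↦ hR (degree_eq_bot.1 (by rw [← degree_taylor R 1, h, degree_zero])))
    (leadingCoeff_taylor ..)
  rwa [degree_taylor] at h

/-- Write P(x) = R(x+1) - R(x). Up to a constant R gives partial sums of `h`, so it grows at most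
like n^(D+1) and has degree at most D + 1; differencing lowers the degree. -/
lemma Polynomial.degree_le_of_sum_le {P : ℚ[X]} {h : ℕ → ℚ} (h0 : ∀ n, 0 ≤ h n)
    (hP : ∀ᶠ n : ℕ in atTop, h n = P.eval (n : ℚ)) {k D : ℕ} {C : ℚ}
    (hC : ∀ n, ∑ j ∈ Finset.range (n + 1), h (k + j) ≤ C * ((n : ℚ) + 1) ^ (D + 1)) :
    P.degree ≤ D := by
  obtain ⟨R, hR⟩ := P.exists_forward_difference_eq
  have hPR : P = taylor 1 R - R := by
    refine eq_of_infinite_eval_eq _ _ (Set.Infinite.mono (s := Set.range ((↑) : ℕ → ℚ)) ?_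
      (Set.infinite_range_of_injective Nat.cast_injective))
    rintro _ ⟨n, rfl⟩
    rw [Set.mem_ofPred_eq, eval_sub, taylor_eval, hR]
  have hC0 : 0 ≤ C := by simpa using (Finset.sum_nonneg fun j _ ↦ h0 (k + j)).trans (hC 0)
  obtain ⟨n₀, hn₀⟩ := eventually_atTop.1 hP
  have hsum (m : ℕ) : R.eval ((k + n₀ + m : ℕ) : ℚ) - R.eval ((k + n₀ : ℕ) : ℚ) =
      ∑ j ∈ Finset.range m, h (k + n₀ + j) := by
    induction m with
    | zero => simp
    | succ m ih =>
      rw [Finset.sum_range_succ, ← ih, hn₀ _ (by omega), ← hR]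
      push_cast
      ring_nf
  have hle (m : ℕ) : ∑ j ∈ Finset.range m, h (k + n₀ + j) ≤ C * ((k + n₀ + m : ℕ) + 1) ^ (D + 1) := by
    calc ∑ j ∈ Finset.range m, h (k + n₀ + j)
        ≤ ∑ j ∈ Finset.range (n₀ + m), h (k + j) := by
          rw [Finset.sum_range_add]
          simp only [← add_assoc]
          exact le_add_of_nonneg_left (Finset.sum_nonneg fun j _ ↦ h0 _)
      _ ≤ ∑ j ∈ Finset.range (n₀ + m + 1), h (k + j) := by
          rw [Finset.sum_range_succ]
          exact le_add_of_nonneg_right (h0 _)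
      _ ≤ C * (((n₀ + m : ℕ) : ℚ) + 1) ^ (D + 1) := hC _
      _ ≤ _ := by
          push_cast
          gcongr
          have : (0 : ℚ) ≤ k := k.cast_nonneg
          linarith
  have hRdeg : R.degree ≤ (D + 1 : ℕ) := by
    refine degree_le_of_eval_le (C := C + |R.eval ((k + n₀ : ℕ) : ℚ)|)
      (eventually_atTop.2 ⟨k + n₀, fun n hn ↦ ?_⟩)
    obtain ⟨m, rfl⟩ := Nat.exists_eq_add_of_le hn
    have h1 := hsum m
    have h2 := hle m
    have h3 : 0 ≤ ∑ j ∈ Finset.range m, h (k + n₀ + j) := Finset.sum_nonneg fun j _ ↦ h0 _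
    have h4 : (1 : ℚ) ≤ (((k + n₀ + m : ℕ) : ℚ) + 1) ^ (D + 1) :=
      one_le_pow₀ (le_add_of_nonneg_left (Nat.cast_nonneg _))
    have h5 : R.eval ((k + n₀ + m : ℕ) : ℚ) = R.eval ((k + n₀ : ℕ) : ℚ) +
        ∑ j ∈ Finset.range m, h (k + n₀ + j) := by rw [← h1]; ring
    rw [h5]
    calc _ ≤ |R.eval ((k + n₀ : ℕ) : ℚ)| * 1 + ∑ j ∈ Finset.range m, h (k + n₀ + j) := by
          rw [mul_one]
          exact (abs_add_le _ _).trans (by rw [abs_of_nonneg h3])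
      _ ≤ |R.eval ((k + n₀ : ℕ) : ℚ)| * (((k + n₀ + m : ℕ) : ℚ) + 1) ^ (D + 1) +
          C * (((k + n₀ + m : ℕ) : ℚ) + 1) ^ (D + 1) := by gcongr
      _ = _ := by ring
  rw [hPR]
  by_cases hR0 : R = 0
  · simp [hR0]
  · exact Order.le_of_lt_succ ((degree_taylor_one_sub_lt hR0).trans_le hRdeg)

variable {A : Type*} [CommRing A]

lemma length_quotient_submoduleOf_le {E : Type*} [AddCommGroup E] [Module A E]
    {W L : Submodule A E} {t : Finset E} (ht : W = Submodule.span A (t : Set E)) {J : Ideal A}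
    (hJ : J • W ≤ L) :
    Module.length A (W ⧸ L.submoduleOf W) ≤ t.card * Module.length A (A ⧸ J) := by
  classical
  have hmem (x : t) : (x : E) ∈ W := ht ▸ Submodule.subset_span x.2
  let f (x : t) : A ⧸ J →ₗ[A] W ⧸ L.submoduleOf W :=
    Submodule.liftQ J (LinearMap.toSpanSingleton A _ (Submodule.mkQ _ ⟨x, hmem x⟩)) fun c hc ↦ by
      rw [LinearMap.mem_ker, LinearMap.toSpanSingleton_apply, ← map_smul, ← LinearMap.mem_ker,
        Submodule.ker_mkQ]
      exact hJ (Submodule.smul_mem_smul hc (hmem x))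
  let F : (t → A ⧸ J) →ₗ[A] W ⧸ L.submoduleOf W := LinearMap.lsum A (fun _ ↦ A ⧸ J) A f
  have hF : Function.Surjective F := by
    intro y
    obtain ⟨w, rfl⟩ := Submodule.mkQ_surjective _ y
    have hle : W ≤ ((LinearMap.range F).comap (Submodule.mkQ _)).map W.subtype := by
      conv_lhs => rw [ht]
      refine Submodule.span_le.2 fun x hx ↦ ⟨⟨x, hmem ⟨x, hx⟩⟩, ?_, rfl⟩
      refine ⟨Pi.single ⟨x, hx⟩ (Submodule.Quotient.mk 1), ?_⟩
      change LinearMap.lsum A (fun _ ↦ A ⧸ J) A f (Pi.single _ _) = _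
      rw [LinearMap.lsum_piSingle]
      exact one_smul A (Submodule.mkQ (L.submoduleOf W) _)
    obtain ⟨w', hw', he⟩ := hle w.2
    rwa [← Subtype.ext he]
  refine (Module.length_le_of_surjective F hF).trans ?_
  rw [Module.length_pi_of_fintype]
  simp

lemma IsFiniteLength.exists_maximalIdeal_pow_smul_le [IsLocalRing A] {M : Type*} [AddCommGroup M]
    [Module A M] (h : IsFiniteLength A M) :
    ∃ s, IsLocalRing.maximalIdeal A ^ s • (⊤ : Submodule A M) = ⊥ := by
  obtain ⟨_, _⟩ := isFiniteLength_iff_isNoetherian_isArtinian.1 h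
  obtain ⟨s, hs⟩ := IsArtinian.monotone_stabilizes
    (⟨fun s ↦ OrderDual.toDual (IsLocalRing.maximalIdeal A ^ s • (⊤ : Submodule A M)),
      fun a b hab ↦ Submodule.smul_mono_left (Ideal.pow_le_pow_right hab)⟩ :
        ℕ →o (Submodule A M)ᵒᵈ)
  refine ⟨s, Submodule.eq_bot_of_le_smul_of_le_jacobson_bot (IsLocalRing.maximalIdeal A) _
    (IsNoetherian.noetherian _) ?_ (IsLocalRing.maximalIdeal_le_jacobson _)⟩
  have : IsLocalRing.maximalIdeal A ^ s • (⊤ : Submodule A M) =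
    IsLocalRing.maximalIdeal A ^ (s + 1) • ⊤ := hs (s + 1) (Nat.le_succ s)
  rw [← mul_smul, ← pow_succ', ← this]

-- By Artin-Rees C ∩ I^(k+j) E = I^j (C ∩ I^k E). A power m^s of the maximal ideal sends C ∩ I^k E
-- into I^k C by finite length, hence kills every later quotient. Each is therefore a module over
-- A/m^s generated by a constant times as many elements as I^j needs.
open scoped Pointwise in
lemma exists_sum_length_traceQuotient_le [IsNoetherianRing A] [IsLocalRing A] {d : ℕ}
    (hd : ringKrullDim A = d) {E : Type*} [AddCommGroup E] [Module A E] [Module.Finite A E]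
    (I : Ideal A) (C : Submodule A E) (h : ∀ n, Module.length A (TraceQuotient I C n) ≠ ⊤) :
    ∃ k c : ℕ, ∀ n, ∑ j ∈ Finset.range (n + 1), (Module.length A (TraceQuotient I C (k + j))).toNat ≤
      c * (n + 1) ^ (d + 1) := by
  classical
  obtain ⟨k, hk⟩ := I.exists_pow_inf_eq_pow_smul C
  obtain ⟨s, hs⟩ := (Module.length_ne_top_iff.1 (h k)).exists_maximalIdeal_pow_smul_le
  have hsk : IsLocalRing.maximalIdeal A ^ s • (C ⊓ I ^ k • ⊤) ≤ I ^ k • C := by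
    refine Submodule.smul_le.2 fun r hr x hx ↦ ?_
    have h0 : r • Submodule.mkQ ((I ^ k • C).submoduleOf (C ⊓ I ^ k • ⊤)) ⟨x, hx⟩ = 0 := by
      rw [← Submodule.mem_bot A, ← hs]
      exact Submodule.smul_mem_smul hr Submodule.mem_top
    rw [← map_smul, ← LinearMap.mem_ker, Submodule.ker_mkQ] at h0
    exact h0
  have hU (j : ℕ) : (C ⊓ I ^ (k + j) • ⊤ : Submodule A E) = I ^ j • (C ⊓ I ^ k • ⊤) := by
    rw [inf_comm, hk (k + j) (Nat.le_add_right _ _), Nat.add_sub_cancel_left, inf_comm]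
  obtain ⟨b, hb⟩ := IsNoetherian.noetherian (C ⊓ I ^ k • ⊤ : Submodule A E)
  have hfin : Module.length A (A ⧸ IsLocalRing.maximalIdeal A ^ s) ≠ ⊤ :=
    length_ne_top_of_maximalIdeal_pow_le _ inferInstance s (by rw [Ideal.annihilator_quotient])
  have hle (j : ℕ) : (Module.length A (TraceQuotient I C (k + j))).toNat ≤
      (I ^ j).spanFinrank * (b.card * (Module.length A (A ⧸ IsLocalRing.maximalIdeal A ^ s)).toNat)
          := by
    obtain ⟨S, hScard, hS⟩ :=
      (IsNoetherian.noetherian (I ^ j)).exists_span_finset_card_eq_spanFinrank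
    have ht : (C ⊓ I ^ (k + j) • ⊤ : Submodule A E) =
        Submodule.span A ((S • b : Finset E) : Set E) := by
      rw [hU, ← hb, Finset.coe_smul]
      conv_lhs => rw [← hS]
      exact Submodule.span_smul_span ..
    have h1 := length_quotient_submoduleOf_le ht (J := IsLocalRing.maximalIdeal A ^ s)
      (L := I ^ (k + j) • C) (by
        rw [hU, ← mul_smul, mul_comm, mul_smul, add_comm, pow_add, mul_smul]
        exact smul_mono_right _ hsk)
    have h2 := ENat.toNat_le_toNat h1 (WithTop.mul_ne_top (ENat.natCast_ne_top _) hfin)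
    rw [ENat.toNat_mul, ENat.toNat_natCast] at h2
    refine h2.trans ?_
    rw [← hScard, ← mul_assoc]
    exact Nat.mul_le_mul_right _ Finset.card_smul_le
  obtain ⟨c, hc⟩ := exists_sum_spanFinrank_pow_le hd I
  refine ⟨k, c * (b.card * (Module.length A (A ⧸ IsLocalRing.maximalIdeal A ^ s)).toNat),
    fun n ↦ (Finset.sum_le_sum fun j _ ↦ hle j).trans ?_⟩
  rw [← Finset.sum_mul, mul_right_comm]
  exact Nat.mul_le_mul_right _ (hc n)

theorem exists_polynomial_degree_le_length_traceQuotient [IsNoetherianRing A] [IsLocalRing A]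
    {d : ℕ}
    (hd : ringKrullDim A = d) {E : Type*} [AddCommGroup E] [Module A E] [Module.Finite A E]
    (I : Ideal A) (C : Submodule A E) (h : ∀ n, Module.length A (TraceQuotient I C n) ≠ ⊤) :
    ∃ P : ℚ[X], P.degree ≤ d ∧ ∀ᶠ n : ℕ in atTop,
      ((Module.length A (TraceQuotient I C n)).toNat : ℚ) = P.eval (n : ℚ) := by
  obtain ⟨P, hP⟩ := exists_polynomial_length_traceQuotient I C h
  obtain ⟨k, c, hc⟩ := exists_sum_length_traceQuotient_le hd I C h
  refine ⟨P, degree_le_of_sum_le (C := c) (fun n ↦ Nat.cast_nonneg _) hP (k := k) fun n ↦ ?_, hP⟩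
  exact_mod_cast hc n

end DegreeBound

/-! ### The kernel of (N/I^n N) ⊗ α as a function of n. -/

section TensorKernels

open TensorProduct

variable {A : Type*} [CommRing A]

lemma ker_rTensor_of_ker_eq_smul_top {N D : Type*} [AddCommGroup N] [Module A N] [AddCommGroup D]
    [Module A D] (K : Type*) [AddCommGroup K] [Module A K] {π : N →ₗ[A] D}
    (hπ : Function.Surjective π) {J : Ideal A} (h : LinearMap.ker π = J • ⊤) :
    LinearMap.ker (LinearMap.rTensor K π) = J • ⊤ := by
  refine le_antisymm (fun x hx ↦ ?_) (Submodule.smul_le.2 fun r hr x _ ↦ ?_)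
  · obtain ⟨y, rfl⟩ := (rTensor_exact K (LinearMap.exact_subtype_ker_map π) hπ x).1 hx
    clear hx
    induction y using TensorProduct.induction_on with
    | zero => rw [map_zero]; exact zero_mem _
    | tmul n k =>
      rw [LinearMap.rTensor_tmul, Submodule.subtype_apply]
      have hn : (n : N) ∈ J • (⊤ : Submodule A N) := h ▸ n.2
      refine Submodule.smul_induction_on (p := fun x ↦ x ⊗ₜ[A] k ∈ J • (⊤ : Submodule A (N ⊗[A] K)))
        hn (fun r hr n _ ↦ ?_) fun n n' h1 h2 ↦ ?_
      · rw [← TensorProduct.smul_tmul']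
        exact Submodule.smul_mem_smul hr Submodule.mem_top
      · rw [TensorProduct.add_tmul]
        exact add_mem h1 h2
    | add y y' hy hy' => rw [map_add]; exact add_mem hy hy'
  · rw [LinearMap.mem_ker]
    induction x using TensorProduct.induction_on with
    | zero => simp
    | tmul n k =>
      have : π (r • n) = 0 := by
        rw [← LinearMap.mem_ker, h]
        exact Submodule.smul_mem_smul hr Submodule.mem_top
      rw [TensorProduct.smul_tmul', LinearMap.rTensor_tmul, this, TensorProduct.zero_tmul]
    | add x y hx hy => rw [smul_add, map_add, hx Submodule.mem_top, hy Submodule.mem_top, add_zero]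

lemma length_ker_eq_of_surjective {X Y Z : Type*} [AddCommGroup X] [Module A X] [AddCommGroup Y]
    [Module A Y] [AddCommGroup Z] [Module A Z] {p : X →ₗ[A] Y} (hp : Function.Surjective p)
    (g : Y →ₗ[A] Z) :
    Module.length A (LinearMap.ker g) = Module.length A
      (LinearMap.ker (g ∘ₗ p) ⧸ (LinearMap.ker p).submoduleOf (LinearMap.ker (g ∘ₗ p))) := by
  let q : LinearMap.ker (g ∘ₗ p) →ₗ[A] LinearMap.ker g := p.restrict fun x hx ↦ hx
  have hq : Function.Surjective q := by
    rintro ⟨y, hy⟩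
    obtain ⟨x, rfl⟩ := hp y
    exact ⟨⟨x, hy⟩, rfl⟩
  have hker : LinearMap.ker q = (LinearMap.ker p).submoduleOf (LinearMap.ker (g ∘ₗ p)) := by
    ext x
    exact Subtype.ext_iff
  rw [← hker]
  exact (q.quotKerEquivOfSurjective hq).symm.length_eq

/-- Applying φ gives an exact sequence 0 → Z/(Z ∩ I^n X) → φ⁻¹(I^n E)/I^n X → (C ∩ I^n E)/I^n C → 0
with Z and C the kernel and image of φ. -/
lemma length_comap_quotient_eq {X E : Type*} [AddCommGroup X] [Module A X] [AddCommGroup E]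
    [Module A E] (φ : X →ₗ[A] E) (I : Ideal A) (n : ℕ) :
    Module.length A (↥((I ^ n • ⊤ : Submodule A E).comap φ) ⧸
        (I ^ n • ⊤ : Submodule A X).submoduleOf ((I ^ n • ⊤ : Submodule A E).comap φ)) =
      Module.length A (LinearMap.ker φ ⧸ (I ^ n • ⊤ : Submodule A X).submoduleOf (LinearMap.ker φ)) +
        Module.length A (TraceQuotient I (LinearMap.range φ) n) := by
  set B := (I ^ n • ⊤ : Submodule A E).comap φ with hB
  have hker : LinearMap.ker φ ≤ B := fun x hx ↦ by
    rw [hB, Submodule.mem_comap, LinearMap.mem_ker.1 hx]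
    exact zero_mem _
  have hmap : (I ^ n • LinearMap.range φ : Submodule A E) = (I ^ n • ⊤ : Submodule A X).map φ := by
    rw [Submodule.map_smul'', Submodule.map_top]
  let i : (LinearMap.ker φ ⧸ (I ^ n • ⊤ : Submodule A X).submoduleOf (LinearMap.ker φ)) →ₗ[A]
      (B ⧸ (I ^ n • ⊤ : Submodule A X).submoduleOf B) :=
    Submodule.mapQ _ _ (Submodule.inclusion hker) fun x hx ↦ hx
  let ψ : B →ₗ[A] ↥(LinearMap.range φ ⊓ I ^ n • ⊤) :=
    φ.restrict fun x hx ↦ ⟨LinearMap.mem_range_self φ x, hx⟩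
  let q : (B ⧸ (I ^ n • ⊤ : Submodule A X).submoduleOf B) →ₗ[A]
      TraceQuotient I (LinearMap.range φ) n :=
    Submodule.mapQ _ _ ψ fun x hx ↦ by
      change φ x ∈ I ^ n • LinearMap.range φ
      rw [hmap]
      exact Submodule.mem_map_of_mem hx
  refine Module.length_eq_add_of_exact i q ?_ ?_ ?_
  · rw [injective_iff_map_eq_zero]
    intro x hx
    obtain ⟨x, rfl⟩ := Submodule.mkQ_surjective _ x
    have hx' : (⟨x, hker x.2⟩ : B) ∈ (I ^ n • ⊤ : Submodule A X).submoduleOf B :=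
      (Submodule.Quotient.mk_eq_zero _).1 hx
    exact (Submodule.Quotient.mk_eq_zero _).2 hx'
  · intro y
    obtain ⟨⟨y, ⟨x, rfl⟩, hy⟩, rfl⟩ := Submodule.mkQ_surjective _ y
    exact ⟨Submodule.mkQ _ ⟨x, hy⟩, rfl⟩
  · intro x
    constructor
    · intro hx
      obtain ⟨x, rfl⟩ := Submodule.mkQ_surjective _ x
      have hx' : ψ x ∈ (I ^ n • LinearMap.range φ).submoduleOf (LinearMap.range φ ⊓ I ^ n • ⊤) :=
        (Submodule.Quotient.mk_eq_zero _).1 hx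
      change φ x ∈ I ^ n • LinearMap.range φ at hx'
      rw [hmap] at hx'
      obtain ⟨y, hy, hxy⟩ := hx'
      refine ⟨Submodule.mkQ _ ⟨x - y, by rw [LinearMap.mem_ker, map_sub, hxy, sub_self]⟩, ?_⟩
      refine (Submodule.Quotient.eq _).2 ?_
      change (x : X) - y - x ∈ (I ^ n • ⊤ : Submodule A X)
      rw [sub_sub_cancel_left]
      exact neg_mem hy
    · rintro ⟨z, rfl⟩
      obtain ⟨z, rfl⟩ := Submodule.mkQ_surjective _ z
      refine (Submodule.Quotient.mk_eq_zero _).2 ?_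
      change φ z ∈ I ^ n • LinearMap.range φ
      rw [LinearMap.mem_ker.1 z.2]
      exact zero_mem _

/-- By right exactness (N/I^n N) ⊗ K is X/I^n X for X = N ⊗ K, and likewise for F, so the kernel is
φ⁻¹(I^n E)/I^n X with φ = N ⊗ α. -/
lemma length_ker_lTensor_quotient {N K F : Type*} [AddCommGroup N] [Module A N] [AddCommGroup K]
    [Module A K] [AddCommGroup F] [Module A F] (α : K →ₗ[A] F) (I : Ideal A) (n : ℕ) :
    Module.length A (LinearMap.ker (LinearMap.lTensor (N ⧸ (I ^ n • ⊤ : Submodule A N)) α)) =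
      Module.length A (LinearMap.ker (LinearMap.lTensor N α) ⧸
        (I ^ n • ⊤ : Submodule A (N ⊗[A] K)).submoduleOf (LinearMap.ker (LinearMap.lTensor N α))) +
      Module.length A (TraceQuotient I (LinearMap.range (LinearMap.lTensor N α)) n) := by
  have hs := Submodule.mkQ_surjective (I ^ n • ⊤ : Submodule A N)
  have hK := ker_rTensor_of_ker_eq_smul_top K hs (Submodule.ker_mkQ _)
  have hF := ker_rTensor_of_ker_eq_smul_top F hs (Submodule.ker_mkQ _)
  rw [length_ker_eq_of_surjective (LinearMap.rTensor_surjective K hs), ← length_comap_quotient_eq,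
    hK, LinearMap.lTensor_comp_rTensor, ← LinearMap.rTensor_comp_lTensor, LinearMap.ker_comp, hF]

/-- The submodules Z ∩ I^n X decrease inside the Artinian module Z, so they stabilize. -/
lemma IsFiniteLength.eventually_length_quotient_eq {X : Type*} [AddCommGroup X] [Module A X]
    {Z : Submodule A X} (hZ : IsFiniteLength A Z) (I : Ideal A) :
    ∃ z : ℕ, ∀ᶠ n : ℕ in Filter.atTop,
      Module.length A (Z ⧸ (I ^ n • ⊤ : Submodule A X).submoduleOf Z) = z := by
  obtain ⟨_, _⟩ := isFiniteLength_iff_isNoetherian_isArtinian.1 hZ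
  obtain ⟨s, hs⟩ := IsArtinian.monotone_stabilizes
    (⟨fun s ↦ OrderDual.toDual ((I ^ s • ⊤ : Submodule A X).submoduleOf Z),
      fun a b hab ↦ Submodule.comap_mono (Submodule.smul_mono_left (Ideal.pow_le_pow_right hab))⟩ :
        ℕ →o (Submodule A Z)ᵒᵈ)
  have hfin := Module.length_ne_top (R := A) (M := Z ⧸ (I ^ s • ⊤ : Submodule A X).submoduleOf Z)
  obtain ⟨z, hz⟩ := ENat.ne_top_iff_exists.1 hfin
  refine ⟨z, Filter.eventually_atTop.2 ⟨s, fun n hn ↦ ?_⟩⟩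
  have : (I ^ s • ⊤ : Submodule A X).submoduleOf Z = (I ^ n • ⊤ : Submodule A X).submoduleOf Z :=
    hs n hn
  rw [← this, hz]

open Polynomial in
theorem exists_polynomial_length_ker_lTensor_quotient [IsNoetherianRing A] [IsLocalRing A] {d : ℕ}
    (hd : ringKrullDim A = d) {N K F : Type*} [AddCommGroup N] [Module A N] [Module.Finite A N]
    [AddCommGroup K] [Module A K] [AddCommGroup F] [Module A F] [Module.Finite A F]
    (α : K →ₗ[A] F) (I : Ideal A) (h : IsFiniteLength A (LinearMap.ker (LinearMap.lTensor N α)))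
    (hI : ∀ n, IsFiniteLength A
      (LinearMap.ker (LinearMap.lTensor (N ⧸ (I ^ n • ⊤ : Submodule A N)) α))) :
    ∃ P : ℚ[X], P.degree ≤ d ∧ ∀ᶠ n : ℕ in Filter.atTop, ((Module.length A
      (LinearMap.ker (LinearMap.lTensor (N ⧸ (I ^ n • ⊤ : Submodule A N)) α))).toNat : ℚ) =
        P.eval (n : ℚ) := by
  have hV (n : ℕ) : Module.length A (TraceQuotient I (LinearMap.range (LinearMap.lTensor N α)) n) ≠
      ⊤ := by
    refine ne_top_of_le_ne_top (Module.length_ne_top_iff.2 (hI n)) ?_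
    rw [length_ker_lTensor_quotient]
    exact le_add_self
  obtain ⟨P, hPd, hP⟩ := exists_polynomial_degree_le_length_traceQuotient hd I _ hV
  obtain ⟨z, hz⟩ := h.eventually_length_quotient_eq I
  refine ⟨C (z : ℚ) + P, (degree_add_le _ _).trans (max_le ?_ hPd), ?_⟩
  · exact degree_C_le.trans (by exact_mod_cast Nat.zero_le d)
  · filter_upwards [hP, hz] with n hn hzn
    rw [length_ker_lTensor_quotient, hzn, ENat.toNat_add (ENat.natCast_ne_top _) (hV n),
      ENat.toNat_natCast, eval_add, eval_C, ← hn]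
    push_cast
    rfl

end TensorKernels

/-! ### Assembly of the theorem. -/

lemma nonempty_ext_equiv_of_equiv_right {A : Type u} [CommRing A] (X : Type u) {L L' : Type u}
    [AddCommGroup X] [Module A X] [AddCommGroup L] [Module A L] [AddCommGroup L'] [Module A L']
    (e : L ≃ₗ[A] L') (i : ℕ) :
    Nonempty (Ext (ModuleCat.of A X) (ModuleCat.of A L) i ≃ₗ[A]
      Ext (ModuleCat.of A X) (ModuleCat.of A L') i) := by
  have h (L₁ L₂ : Type u) [AddCommGroup L₁] [Module A L₁] [AddCommGroup L₂] [Module A L₂]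
      (f : L₁ ≃ₗ[A] L₂) (x : Ext (ModuleCat.of A X) (ModuleCat.of A L₁) i) :
      (x.comp (Ext.mk₀ (ModuleCat.ofHom f.toLinearMap)) (add_zero i)).comp
        (Ext.mk₀ (ModuleCat.ofHom f.symm.toLinearMap)) (add_zero i) = x := by
    rw [Ext.comp_assoc_of_third_deg_zero, Ext.mk₀_comp_mk₀, ← ModuleCat.ofHom_comp,
      LinearEquiv.comp_coe, LinearEquiv.self_trans_symm]
    exact Ext.comp_mk₀_id x
  refine ⟨LinearEquiv.ofBijective ((Ext.mk₀ (ModuleCat.ofHom e.toLinearMap)).postcompOfLinear A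
    (ModuleCat.of A X) (add_zero i)) (Function.bijective_iff_has_inverse.2
      ⟨fun y ↦ y.comp (Ext.mk₀ (ModuleCat.ofHom e.symm.toLinearMap)) (add_zero i),
        h L L' e, h L' L e.symm⟩)⟩

lemma IsMaximalCohenMacaulay.isStablyFiniteLength {A : Type u} [CommRing A] [IsNoetherianRing A]
    [IsLocalRing A] {d : ℕ} (hd : ringKrullDim A = (d : WithBot ℕ∞)) {M : Type u} [AddCommGroup M]
    [Module A M] (hM : IsMaximalCohenMacaulay A M) (hfree : IsFreeOnPuncturedSpectrum A M) {r : ℕ}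
    (hr : SelfExtVanishesAbove A r) (hrd : r ≤ d) : IsStablyFiniteLength A M := by
  obtain ⟨hfin, rs, hrs, hw, hlen⟩ := hM
  have hlen' : rs.length = d := by
    rw [hd] at hlen
    exact_mod_cast hlen
  exact ⟨hfin, fun i ↦ hr.of_isWeaklyRegular rs hrs M hw (i + 1) (by omega),
    exists_pow_factorsThroughFree hfree⟩

/-- The formula for duals is applied to G = M*, since M is isomorphic to its double dual. -/
lemma exists_length_ext_eq_length_ker_mul {A : Type u} [CommRing A] [IsNoetherianRing A]
    [IsLocalRing A] {r : ℕ} (hr : SelfExtVanishesAbove A r)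
    (hk : Nontrivial (SelfExt A (A ⧸ IsLocalRing.maximalIdeal A) r)) {M : Type u} [AddCommGroup M]
    [Module A M] (hM : IsStablyFiniteLength A M) {j : ℕ} (hj : r < j) :
    ∃ (F : Type u) (_ : AddCommGroup F) (_ : Module A F) (K : Type u) (_ : AddCommGroup K)
      (_ : Module A K) (_ : Module.Finite A F) (α : K →ₗ[A] F),
      ∀ (D : Type u) [AddCommGroup D] [Module A D] [Module.Finite A D],
        IsFiniteLength A (LinearMap.ker (LinearMap.lTensor D α)) ∧
        Module.length A (Ext (ModuleCat.of A D) (ModuleCat.of A M) j) =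
          Module.length A (LinearMap.ker (LinearMap.lTensor D α)) *
            Module.length A (SelfExt A (A ⧸ IsLocalRing.maximalIdeal A) r) := by
  obtain ⟨i, rfl⟩ := Nat.exists_eq_add_of_le (Nat.succ_le_of_lt hj)
  have := hM.finite
  obtain ⟨F, i1, i2, K, i3, i4, i5, -, α, h⟩ :=
    exists_length_ext_dual_eq hr hk i (Module.Dual A M) (hM.dual hr)
  refine ⟨F, i1, i2, K, i3, i4, i5, α, fun D _ _ _ ↦ ⟨(h D).1, ?_⟩⟩
  obtain ⟨e⟩ := nonempty_ext_equiv_of_equiv_right D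
    (LinearEquiv.ofBijective _ (hM.acyclic.eval_bijective hr)) (r + 1 + i)
  rw [← (h D).2]
  exact e.length_eq

theorem lemma1p3 (A : Type u) [CommRing A] [IsNoetherianRing A] [IsLocalRing A]
    (hA : IsGorensteinLocalRing A)
    (d : ℕ) (hd : ringKrullDim A = (d : WithBot ℕ∞))
    (M : Type u) [AddCommGroup M] [Module A M]
    (hM : IsMaximalCohenMacaulay A M) (hfree : IsFreeOnPuncturedSpectrum A M)
    (N : Type u) [AddCommGroup N] [Module A N] [Module.Finite A N]
    (I : Ideal A) (j : ℕ) (hj : d + 1 ≤ j) :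
    (∀ n : ℕ, extLength A N M I j n ≠ ⊤) ∧
      IsOfPolynomialTypeDegreeLE (fun n : ℕ => (extLength A N M I j n).toNat) d := by
  obtain ⟨r, hr, hk⟩ := exists_selfExtVanishesAbove hA
  have hrd : r ≤ d := le_of_selfExt_residue_nontrivial hr hk hd
  obtain ⟨F, _, _, K, _, _, _, α, h⟩ := exists_length_ext_eq_length_ker_mul hr hk
    (hM.isStablyFiniteLength hd hfree hr hrd) (j := j) (by omega)
  have hc : Module.length A (SelfExt A (A ⧸ IsLocalRing.maximalIdeal A) r) ≠ ⊤ :=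
    length_selfExt_residue_ne_top r
  refine ⟨fun n ↦ ?_, ?_⟩
  · rw [extLength, (h _).2]
    exact WithTop.mul_ne_top (Module.length_ne_top_iff.2 (h _).1) hc
  · obtain ⟨P, hPd, hP⟩ := exists_polynomial_length_ker_lTensor_quotient hd (N := N) α I (h N).1
      fun n ↦ (h _).1
    -- The shift by `taylor 1` accounts for the exponent n + 1 in I^(n+1); the scalar is the
    -- multiplicity ℓ(Ext^r(k, A)).
    refine ⟨((Module.length A (SelfExt A (A ⧸ IsLocalRing.maximalIdeal A) r)).toNat : ℚ) •
      Polynomial.taylor 1 P, (Polynomial.degree_smul_le _ _).trans ?_, ?_⟩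
    · rwa [Polynomial.degree_taylor]
    · filter_upwards [(Filter.tendsto_add_atTop_nat 1).eventually hP] with n hn
      rw [extLength, (h _).2, ENat.toNat_mul, Polynomial.eval_smul, Polynomial.taylor_eval,
        smul_eq_mul, mul_comm]
      push_cast at hn ⊢
      rw [hn]
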